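/- Let $N\ge 2$, $s\in(\tfrac12,1)$ and $\mathbf p\in[2,\infty)$. Let $\alpha_{\mathbf p}\in(0,\tfrac\pi2]$ be the angle for which the spherical cap $A_{\mathbf p}=\{|z|=1:\angle(e_1,z)<\alpha_{\mathbf p}\}\subset\mathbb R^N$ satisfies $\mathbf p-1=\int_{A_{\mathbf p}}\langle z,e_1\rangle^2d\sigma\big/\int_{A_{\mathbf p}}\langle z,e_2\rangle^2d\sigma$, where $\sigma$ is the surface measure. For $|y|=1$ and $a\ge 0$ put $T^{a,\infty}_{\mathbf p}(y)=\{z\in\mathbb R^N:\angle(y,z)<\alpha_{\mathbf p},\ |z|>a\}$ and $T^{a,\infty}_{\mathbf p}=T^{a,\infty}_{\mathbf p}(e_1)$. Let $d\mu(z)=C(N,s)|z|^{-N-2s}dz$ with $C(N,s)=\frac{4^s s\,\Gamma(N/2+s)}{\pi^{N/2}\Gamma(1-s)}$. For a bounded Borel function $u:\mathbb R^N\to\mathbb R$ and $\epsilon>0$ define $$\mathcal A_\epsilon u(x)=\frac12\Big(\sup_{|y|=1}\frac{1}{\mu(T^{\epsilon,\infty}_{\mathbf p}(y))}\int_{T^{\epsilon,\infty}_{\mathbf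 p}(y)}u(x+z)\,d\mu(z)+\inf_{|y|=1}\frac{1}{\mu(T^{\epsilon,\infty}_{\mathbf p}(y))}\int_{T^{\epsilon,\infty}_{\mathbf p}(y)}u(x+z)\,d\mu(z)\Big).$$ Let $\mathcal D\subset\mathbb R^N$ be open and bounded, let $F:\mathbb R^N\to\mathbb R$ be bounded and uniformly continuous, and let $\epsilon\in(0,1)$. The game. Let $\Omega_1=T^{1,\infty}_{\mathbf p}\times\{1,2\}$ carry the product $\mathbb P_1$ of the normalized measure $\mu/\mu(T^{1,\infty}_{\mathbf p})$ and the uniform probability on $\{1,2\}$, and let $(\Omega,\mathbb P)=(\Omega_1,\mathbb P_1)^{\mathbb N}$, with elements $\omega=\{(z_n,s_n)\}_{n\ge1}$. A strategy is a sequence of Borel maps $\sigma^n:H_n\to\{|y|=1\}$, $n\ge 0$, on the finite histories $H_n=\mathbb R^N\times(\mathbb R^N\times\Omega_1)^n$. For a unit vector $y$ let $R_{y}\in SO(N)$ be the rotation in the plane spanned by $e_1$ and $y$ that sends $e_1$ to $y$ ($R_{e_1}=\mathrm{Id}$, and $R_{-e_1}$ is the half-turn in the plane spanned by $e_1,e_2$).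 Given $x\in\mathbb R^N$ and strategies $\sigma_I,\sigma_{II}$, put $X_0=x$ and $X_n=X_{n-1}+\epsilon R_{y_n}z_n$, where $y_n$ is the value of $\sigma_I^{n-1}$ if $s_n=1$ and of $\sigma_{II}^{n-1}$ if $s_n=2$, at the history $(X_0,(X_1,z_1,s_1),\dots,(X_{n-1},z_{n-1},s_{n-1}))$. Let $\tau=\min\{n\ge1: X_n\notin\mathcal D\}$, which is finite almost surely, and define $$u_I^\epsilon(x)=\sup_{\sigma_I}\inf_{\sigma_{II}}\mathbb E[F(X_\tau)],\qquad u_{II}^\epsilon(x)=\inf_{\sigma_{II}}\sup_{\sigma_I}\mathbb E[F(X_\tau)].$$ Then there is exactly one bounded Borel function $u_\epsilon:\mathbb R^N\to\mathbb R$ with $$u_\epsilon=\mathcal A_\epsilon u_\epsilon\ \text{ in }\mathcal D,\qquad u_\epsilon=F\ \text{ in }\mathbb R^N\setminus\mathcal D,$$ and $u_I^\epsilon=u_{II}^\epsilon$ on $\mathbb R^N$, while $u_I^\epsilon=u_{II}^\epsilon=u_\epsilon$ in $\mathcal D$. -/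

import Mathlib

open MeasureTheory

namespace NonlocalTug

/-- The space `ℝᴺ`. -/
abbrev E (N : ℕ) := EuclideanSpace ℝ (Fin N)

/-- The unit sphere `{|y| = 1}` of `ℝᴺ`. -/
abbrev S (N : ℕ) := Metric.sphere (0 : E N) 1

section Cone

variable {N : ℕ} [N.AtLeastTwo]

/-- First vector of the standard basis. -/
noncomputable def e₁ : E N := EuclideanSpace.single (0 : Fin N) (1 : ℝ)

/-- Second vector of the standard basis (it differs from `e₁` because `2 ≤ N`). -/
noncomputable def e₂ : E N := EuclideanSpace.single (1 : Fin N) (1 : ℝ)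

/-- The spherical cap of directions making an angle smaller than `α` with `e₁`. -/
def cap (N : ℕ) [N.AtLeastTwo] (α : ℝ) : Set (S N) :=
  {z | InnerProductGeometry.angle e₁ (z : E N) < α}

/-- `α ∈ (0, π/2]` is an aperture angle for the exponent `p`:
`p - 1 = ∫_{cap} ⟨z, e₁⟩² dσ / ∫_{cap} ⟨z, e₂⟩² dσ`, with `σ` the surface measure of the sphere. -/
def IsApertureAngle (N : ℕ) [N.AtLeastTwo] (p α : ℝ) : Prop :=
  0 < α ∧ α ≤ Real.pi / 2 ∧
    p - 1 = (∫ z in cap N α, inner ℝ (z : E N) e₁ ^ 2 ∂(volume : Measure (E N)).toSphere) /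
      (∫ z in cap N α, inner ℝ (z : E N) e₂ ^ 2 ∂(volume : Measure (E N)).toSphere)

/-- The aperture angle `α_p` (for `2 ≤ p` it exists, see `isApertureAngle_apertureAngle`). -/
noncomputable def apertureAngle (N : ℕ) [N.AtLeastTwo] (p : ℝ) : ℝ :=
  Classical.epsilon (IsApertureAngle N p)

/-- The truncated infinite cone `T_p^{a,∞}(y)`. -/
def cone (p a : ℝ) (y : E N) : Set (E N) :=
  {z | InnerProductGeometry.angle y z < apertureAngle N p ∧ a < ‖z‖}

/-- The rotation `R_{y,e₁}`, which sends `e₁` to the unit vector `y` within the plane spanned by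
`e₁` and `y` and fixes the orthogonal complement of this plane, written as the product of the
reflections in the hyperplanes orthogonal to `e₁` and to `e₁ + y`. For `y = -e₁` the two vectors
span no plane, and we take the half-turn in the plane spanned by `e₁` and `e₂`. -/
noncomputable def rot (y : S N) : E N ≃ₗᵢ[ℝ] E N :=
  open Classical in
  if (y : E N) = -e₁ then
    (Submodule.reflection (Submodule.span ℝ {(e₁ : E N)})ᗮ).trans
      (Submodule.reflection (Submodule.span ℝ {(e₂ : E N)})ᗮ)
  else
    (Submodule.reflection (Submodule.span ℝ {(e₁ : E N)})ᗮ).trans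
      (Submodule.reflection (Submodule.span ℝ {(e₁ : E N) + (y : E N)})ᗮ)

end Cone

/-- The map of the sphere induced by a linear isometry preserves the surface measure. -/
lemma toSphere_preserving {N : ℕ} (R : E N ≃ₗᵢ[ℝ] E N) (φ : S N → S N) (hφ : Measurable φ)
    (h : ∀ z, (φ z : E N) = R z) :
    MeasurePreserving φ (volume : Measure (E N)).toSphere (volume : Measure (E N)).toSphere := by
  refine ⟨hφ, ?_⟩
  ext t ht
  rw [Measure.map_apply hφ ht, Measure.toSphere_apply' _ ht, Measure.toSphere_apply' _ (hφ ht)]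
  congr 1
  have hR : MeasurePreserving R.toHomeomorph.toMeasurableEquiv
      (volume : Measure (E N)) volume := R.measurePreserving
  refine (congrArg _ ?_).trans (hR.measure_preimage_equiv _)
  ext w
  simp only [Set.mem_smul, Set.mem_image, Set.mem_preimage]
  constructor
  · rintro ⟨r, hr, _, ⟨z, hz, rfl⟩, rfl⟩
    exact ⟨r, hr, _, ⟨φ z, hz, rfl⟩, by rw [h]; exact (R.map_smul r _).symm⟩
  · rintro ⟨r, hr, _, ⟨z, hz, rfl⟩, hw⟩
    have hz1 : ‖R.symm (z : E N)‖ = 1 := by simp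
    let z' : S N := ⟨R.symm z, by simp⟩
    have hz' : φ z' = z := Subtype.ext (by rw [h]; exact R.apply_symm_apply _)
    refine ⟨r, hr, _, ⟨z', by rwa [hz'], rfl⟩, ?_⟩
    apply R.injective
    rw [R.map_smul]
    show r • R (R.symm z) = _
    rw [R.apply_symm_apply, hw]
    rfl

section ConeFacts

variable {N : ℕ} [N.AtLeastTwo]

lemma norm_e₁ : ‖(e₁ : E N)‖ = 1 := by simp [e₁]

lemma norm_e₂ : ‖(e₂ : E N)‖ = 1 := by simp [e₂]

lemma inner_e₁_e₂ : inner ℝ (e₁ : E N) e₂ = 0 := by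
  have h : (0 : Fin N) ≠ 1 := by
    have h2 : 2 ≤ N := Nat.AtLeastTwo.prop
    intro h
    have := congrArg Fin.val h
    rw [Fin.val_zero, Fin.val_one', Nat.mod_eq_of_lt h2] at this
    exact zero_ne_one this
  simp [e₁, e₂, EuclideanSpace.inner_single_left, h]

lemma rot_e₁ (y : S N) : rot y e₁ = (y : E N) := by
  have hy : ‖(y : E N)‖ = 1 := by simp
  unfold rot
  split_ifs with h
  · rw [LinearIsometryEquiv.trans_apply,
      Submodule.reflection_orthogonalComplement_singleton_eq_neg,
      Submodule.reflection_mem_subspace_eq_self, h]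
    rw [Submodule.mem_orthogonal_singleton_iff_inner_left, inner_neg_left, inner_e₁_e₂, neg_zero]
  · have := Submodule.reflection_sub (v := (y : E N)) (w := -e₁) (by rw [norm_neg, norm_e₁, hy])
    rw [LinearIsometryEquiv.trans_apply,
      Submodule.reflection_orthogonalComplement_singleton_eq_neg]
    simp only [sub_neg_eq_add, add_comm (y : E N)] at this
    rw [← this, Submodule.reflection_reflection]

lemma rot_of_orthogonal (y : S N) (hy : (y : E N) ≠ -e₁) (z : E N) (hz₁ : inner ℝ z e₁ = 0)
    (hz : inner ℝ z (y : E N) = 0) : rot y z = z := by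
  unfold rot
  rw [if_neg hy, LinearIsometryEquiv.trans_apply,
    Submodule.reflection_mem_subspace_eq_self (x := z), Submodule.reflection_mem_subspace_eq_self]
  · rw [Submodule.mem_orthogonal_singleton_iff_inner_left, inner_add_right, hz₁, hz, add_zero]
  · rwa [Submodule.mem_orthogonal_singleton_iff_inner_left]

lemma det_rot (y : S N) : LinearMap.det ((rot y).toLinearEquiv : E N →ₗ[ℝ] E N) = 1 := by
  have key : ∀ v : E N, v ≠ 0 → LinearMap.det
      ((Submodule.reflection (Submodule.span ℝ {v})ᗮ).toLinearEquiv : E N →ₗ[ℝ] E N) = -1 := by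
    intro v hv
    have := Submodule.det_reflection (K := (Submodule.span ℝ {v})ᗮ)
    rw [Submodule.orthogonal_orthogonal, finrank_span_singleton hv, pow_one] at this
    exact this
  have h₁ : (e₁ : E N) ≠ 0 := by
    rw [← norm_ne_zero_iff, norm_e₁]; exact one_ne_zero
  have h₂ : (e₂ : E N) ≠ 0 := by
    rw [← norm_ne_zero_iff, norm_e₂]; exact one_ne_zero
  unfold rot
  split_ifs with h
  · rw [LinearIsometryEquiv.toLinearEquiv_trans, LinearEquiv.coe_trans, LinearMap.det_comp,
      key _ h₁, key _ h₂]
    norm_num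
  · rw [LinearIsometryEquiv.toLinearEquiv_trans, LinearEquiv.coe_trans, LinearMap.det_comp,
      key _ h₁, key _ fun h' => h (eq_neg_of_add_eq_zero_right h')]
    norm_num

lemma angle_lt_iff (z : S N) {α : ℝ} (h0 : 0 ≤ α) (hπ : α ≤ Real.pi) :
    InnerProductGeometry.angle e₁ (z : E N) < α ↔ Real.cos α < inner ℝ (z : E N) e₁ := by
  have hz : ‖(z : E N)‖ = 1 := by simp
  have hc : Real.cos (InnerProductGeometry.angle e₁ (z : E N)) = inner ℝ (z : E N) e₁ := by
    rw [InnerProductGeometry.cos_angle, norm_e₁, hz, real_inner_comm]; simp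
  rw [← hc]
  exact (Real.strictAntiOn_cos.lt_iff_gt ⟨h0, hπ⟩
    ⟨InnerProductGeometry.angle_nonneg _ _, InnerProductGeometry.angle_le_pi _ _⟩).symm

lemma toSphere_level (c : ℝ) (h0 : 0 ≤ c) (h1 : c < 1) :
    (volume : Measure (E N)).toSphere {z : S N | inner ℝ (z : E N) e₁ = c} = 0 := by
  have hm : MeasurableSet {z : S N | inner ℝ (z : E N) e₁ = c} :=
    (isClosed_eq (by fun_prop) continuous_const).measurableSet
  rw [Measure.toSphere_apply' _ hm]
  have hnull : (volume : Measure (E N)) {w : E N | inner ℝ w e₁ = c * ‖w‖} = 0 := by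
    refine Measure.addHaar_eq_zero_of_disjoint_translates _
      (fun n : ℕ => ((1 : ℝ) / (n + 1)) • (e₁ : E N)) ?_ ?_
      (isClosed_eq (by fun_prop) (by fun_prop)).measurableSet
    · refine (Metric.isBounded_closedBall (x := (0 : E N)) (r := 1)).subset ?_
      rintro _ ⟨n, rfl⟩
      rw [mem_closedBall_zero_iff, norm_smul, norm_e₁, mul_one, Real.norm_of_nonneg (by positivity)]
      rw [div_le_one (by positivity)]
      linarith [Nat.cast_nonneg (α := ℝ) n]
    · intro m n hmn
      rw [Function.onFun, Set.disjoint_left]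
      rintro _ ⟨_, rfl, v, hv, rfl⟩ ⟨_, rfl, w, hw, hvw⟩
      apply hmn
      simp only [Set.mem_ofPred_eq] at hv hw hvw
      set a : ℝ := 1 / ((m : ℝ) + 1) with ha
      set b : ℝ := 1 / ((n : ℝ) + 1) with hb
      have hwv : w = v + (a - b) • (e₁ : E N) := by
        rw [sub_smul]
        have : w = (a • (e₁ : E N) + v) - b • (e₁ : E N) := by rw [← hvw]; abel
        rw [this]; abel
      have i1 : inner ℝ w e₁ = inner ℝ v e₁ + (a - b) := by
        rw [hwv, inner_add_left, inner_smul_left, real_inner_self_eq_norm_sq, norm_e₁]; simp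
      have i2 : ‖w‖ ^ 2 = ‖v‖ ^ 2 + 2 * (a - b) * inner ℝ v e₁ + (a - b) ^ 2 := by
        rw [hwv, norm_add_sq_real, inner_smul_right, norm_smul, norm_e₁, mul_one, Real.norm_eq_abs,
          sq_abs]
        ring
      have hab : a = b := by
        by_contra hne
        have hd : a - b ≠ 0 := sub_ne_zero.2 hne
        have hv0 : 0 ≤ inner ℝ v e₁ := by rw [hv]; positivity
        have hw0 : 0 ≤ inner ℝ w e₁ := by rw [hw]; positivity
        have hv2 : inner ℝ v e₁ ^ 2 = c ^ 2 * ‖v‖ ^ 2 := by rw [hv]; ring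
        have hw2 : inner ℝ w e₁ ^ 2 = c ^ 2 * ‖w‖ ^ 2 := by rw [hw]; ring
        rw [i2, i1] at hw2
        have hc2 : 0 < 1 - c ^ 2 := by nlinarith
        have e : (1 - c ^ 2) * ((a - b) * (2 * inner ℝ v e₁ + (a - b))) = 0 := by linarith
        rcases mul_eq_zero.1 e with e | e
        · exact hc2.ne' e
        rcases mul_eq_zero.1 e with e | e
        · exact hd e
        rw [i1] at hw0
        exact hd (by linarith)
      have hm0 : (0 : ℝ) < (m : ℝ) + 1 := by positivity
      have hn0 : (0 : ℝ) < (n : ℝ) + 1 := by positivity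
      rw [ha, hb, div_eq_div_iff hm0.ne' hn0.ne'] at hab
      have : (m : ℝ) = n := by linarith
      exact_mod_cast this
  refine mul_eq_zero_of_right _ (measure_mono_null ?_ hnull)
  rintro _ ⟨r, hr, _, ⟨z, hz, rfl⟩, rfl⟩
  have hz1 : ‖(z : E N)‖ = 1 := by simp
  simp only [Set.mem_ofPred_eq] at hz ⊢
  rw [inner_smul_left, hz, norm_smul, hz1, Real.norm_of_nonneg hr.1.le]
  simp [mul_comm]

/-- For `2 ≤ p` there is an aperture angle. -/
lemma exists_isApertureAngle {p : ℝ} (hp : 2 ≤ p) : ∃ α, IsApertureAngle N p α := by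
  classical
  set σ := (volume : Measure (E N)).toSphere with hσ
  let A : S N → ℝ := fun z => inner ℝ (z : E N) e₁
  let B : S N → ℝ := fun z => inner ℝ (z : E N) e₂
  have hA : Continuous A := by fun_prop
  have hB : Continuous B := by fun_prop
  have hint : ∀ f : S N → ℝ, Continuous f → Integrable f σ := fun f hf =>
    hf.integrable_of_hasCompactSupport (HasCompactSupport.of_compactSpace f)
  let h : S N → ℝ := fun z => A z ^ 2 - (p - 1) * B z ^ 2
  have hh : Continuous h := by fun_prop
  have hangle : Continuous fun z : S N => InnerProductGeometry.angle e₁ (z : E N) := by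
    unfold InnerProductGeometry.angle
    have : ∀ z : S N, ‖(e₁ : E N)‖ * ‖(z : E N)‖ ≠ 0 := fun z => by simp [norm_e₁]
    fun_prop (disch := assumption)
  have hcapo : ∀ α, IsOpen (cap N α) := fun α => isOpen_lt hangle continuous_const
  have hcap : ∀ α, MeasurableSet (cap N α) := fun α => (hcapo α).measurableSet
  have hAB : ∀ z, A z ^ 2 + B z ^ 2 ≤ 1 := by
    intro z
    have hz : ‖(z : E N)‖ = 1 := by simp
    have hw := sq_nonneg ‖(z : E N) - (A z • (e₁ : E N) + B z • (e₂ : E N))‖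
    rw [norm_sub_sq_real, norm_add_sq_real, inner_add_right, inner_smul_right, inner_smul_right,
      inner_smul_left, inner_smul_right, inner_e₁_e₂, norm_smul, norm_smul, norm_e₁, norm_e₂, hz,
      mul_one, mul_one, Real.norm_eq_abs, Real.norm_eq_abs, sq_abs, sq_abs] at hw
    change 0 ≤ 1 ^ 2 - 2 * (A z * A z + B z * B z) + _ at hw
    linarith
  let g : ℝ → ℝ := fun α => ∫ z in cap N α, h z ∂σ
  -- continuity of `g`
  have hg : ContinuousOn g (Set.Ioc 0 (Real.pi / 2)) := by
    intro α hα
    refine ContinuousAt.continuousWithinAt ?_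
    have : g = fun α => ∫ z, (cap N α).indicator h z ∂σ := by
      funext β; exact (integral_indicator (hcap β)).symm
    rw [this]
    refine continuousAt_of_dominated (bound := fun z => ‖h z‖)
      (Filter.Eventually.of_forall fun β =>
        (hh.measurable.indicator (hcap β)).aestronglyMeasurable)
      (Filter.Eventually.of_forall fun β => Filter.Eventually.of_forall fun z =>
        norm_indicator_le_norm_self _ _) (hint h hh).norm ?_
    have hnull : σ {z : S N | A z = Real.cos α} = 0 := by
      refine toSphere_level _ (Real.cos_nonneg_of_neg_pi_div_two_le_of_le (by linarith [hα.1,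
        Real.pi_pos]) hα.2) ?_
      rw [← Real.cos_zero]
      exact Real.cos_lt_cos_of_nonneg_of_le_pi le_rfl (by linarith [hα.2, Real.pi_pos]) hα.1
    have hae : ∀ᵐ z ∂σ, A z ≠ Real.cos α := by rw [ae_iff]; simpa using hnull
    filter_upwards [hae] with z hz
    have hne : InnerProductGeometry.angle e₁ (z : E N) ≠ α := by
      intro he
      apply hz
      rw [← he, InnerProductGeometry.cos_angle, norm_e₁, norm_eq_of_mem_sphere, real_inner_comm]
      simp [A]
    rcases lt_or_gt_of_ne hne with hlt | hgt
    · refine (continuousAt_const (y := h z)).congr ?_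
      filter_upwards [lt_mem_nhds hlt] with β hβ
      exact (Set.indicator_of_mem (s := cap N β) hβ h).symm
    · refine (continuousAt_const (y := (0 : ℝ))).congr ?_
      filter_upwards [gt_mem_nhds hgt] with β hβ
      exact (Set.indicator_of_notMem (s := cap N β) (not_lt.2 hβ.le) h).symm
  -- small angles
  obtain ⟨a, ha0, ha1, ha⟩ : ∃ a : ℝ, 0 < a ∧ a ≤ Real.pi / 2 ∧
      0 ≤ Real.cos a ^ 2 - (p - 1) * Real.sin a ^ 2 := by
    have hc : Continuous fun a : ℝ => Real.cos a ^ 2 - (p - 1) * Real.sin a ^ 2 := by fun_prop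
    have h0 : ∀ᶠ a in nhdsWithin (0 : ℝ) (Set.Ioi 0),
        0 < Real.cos a ^ 2 - (p - 1) * Real.sin a ^ 2 :=
      nhdsWithin_le_nhds (hc.continuousAt.eventually (lt_mem_nhds (by simp)))
    have h1 : ∀ᶠ a in nhdsWithin (0 : ℝ) (Set.Ioi 0), a ∈ Set.Ioo 0 (Real.pi / 2) :=
      Ioo_mem_nhdsGT (by positivity)
    obtain ⟨a, h2, h3⟩ := (h0.and h1).exists
    exact ⟨a, h3.1, h3.2.le, h2.le⟩
  have hga : 0 ≤ g a := by
    refine setIntegral_nonneg (hcap a) fun z hz => ?_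
    have hz' : Real.cos a < A z := (angle_lt_iff z ha0.le (by linarith [Real.pi_pos])).1 hz
    have hc : 0 ≤ Real.cos a :=
      Real.cos_nonneg_of_neg_pi_div_two_le_of_le (by linarith [Real.pi_pos]) ha1
    have hA2 : Real.cos a ^ 2 ≤ A z ^ 2 := by nlinarith
    have hB2 : B z ^ 2 ≤ Real.sin a ^ 2 := by nlinarith [hAB z, Real.sin_sq_add_cos_sq a]
    show 0 ≤ A z ^ 2 - (p - 1) * B z ^ 2
    nlinarith
  -- the right angle
  have hgpi : g (Real.pi / 2) ≤ 0 := by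
    have hsplit : g (Real.pi / 2) = (∫ z in cap N (Real.pi / 2), (A z ^ 2 - B z ^ 2) ∂σ)
        - ∫ z in cap N (Real.pi / 2), (p - 2) * B z ^ 2 ∂σ := by
      rw [← integral_sub ((hint _ (by fun_prop)).integrableOn) ((hint _ (by fun_prop)).integrableOn)]
      refine integral_congr_ae (Filter.Eventually.of_forall fun z => ?_)
      simp only [h]
      ring
    have hB0 : 0 ≤ ∫ z in cap N (Real.pi / 2), (p - 2) * B z ^ 2 ∂σ :=
      setIntegral_nonneg (hcap _) fun z _ => mul_nonneg (by linarith) (sq_nonneg _)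
    have hcapeq : cap N (Real.pi / 2) = {z | 0 < A z} := by
      ext z
      have := angle_lt_iff z (α := Real.pi / 2) (by positivity) (by linarith [Real.pi_pos])
      rw [Real.cos_pi_div_two] at this
      exact this
    let k : S N → ℝ := fun z => A z ^ 2 - B z ^ 2
    have hk : Continuous k := by fun_prop
    -- the antipodal map
    let ν : S N → S N := fun z => -z
    have hν : MeasurePreserving ν σ σ :=
      toSphere_preserving (LinearIsometryEquiv.neg ℝ) ν (by fun_prop) fun z => rfl
    have hAν : ∀ z, A (ν z) = -A z := fun z => by simp [A, ν, inner_neg_left]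
    have hBν : ∀ z, B (ν z) = -B z := fun z => by simp [B, ν, inner_neg_left]
    have hνe : MeasurableEmbedding ν := (Homeomorph.neg (S N)).measurableEmbedding
    have hneg : ∫ z in {z | A z < 0}, k z ∂σ = ∫ z in {z | 0 < A z}, k z ∂σ := by
      have := hν.setIntegral_preimage_emb hνe k {z | 0 < A z}
      rw [← this]
      have hs : ν ⁻¹' {z | 0 < A z} = {z | A z < 0} := by
        ext z; simp [hAν]
      rw [hs]
      refine integral_congr_ae (Filter.Eventually.of_forall fun z => ?_)
      simp [k, hAν, hBν]
    -- the exchange of the first two axes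
    let τ : E N ≃ₗᵢ[ℝ] E N := Submodule.reflection (Submodule.span ℝ {(e₁ : E N) - e₂})ᗮ
    have hτ1 : τ e₁ = e₂ := Submodule.reflection_sub (by rw [norm_e₁, norm_e₂])
    have hτ2 : τ e₂ = e₁ := by rw [← hτ1]; exact Submodule.reflection_reflection _ _
    let θ : S N → S N := fun z => ⟨τ z, by simp⟩
    have hθm : Measurable θ :=
      ((τ.continuous.comp continuous_subtype_val).subtype_mk _).measurable
    have hθ : MeasurePreserving θ σ σ := toSphere_preserving τ θ hθm fun z => rfl
    have hττ : ∀ x y : E N, inner ℝ (τ x) y = inner ℝ x (τ y) := fun x y => by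
      rw [← τ.inner_map_map (τ x) y]
      congr 1
      exact Submodule.reflection_reflection _ _
    have hAθ : ∀ z, A (θ z) = B z := fun z => by
      show inner ℝ (τ z) e₁ = inner ℝ (z : E N) e₂
      rw [hττ, hτ1]
    have hBθ : ∀ z, B (θ z) = A z := fun z => by
      show inner ℝ (τ z) e₂ = inner ℝ (z : E N) e₁
      rw [hττ, hτ2]
    have htot : ∫ z, k z ∂σ = 0 := by
      have h1 : ∫ z, k (θ z) ∂σ = ∫ z, k z ∂σ := by
        rw [← integral_map hθ.measurable.aemeasurable hk.aestronglyMeasurable, hθ.map_eq]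
      have h2 : ∫ z, k (θ z) ∂σ = - ∫ z, k z ∂σ := by
        rw [← integral_neg]
        refine integral_congr_ae (Filter.Eventually.of_forall fun z => ?_)
        simp [k, hAθ, hBθ]
      linarith
    have hmp : MeasurableSet {z | 0 < A z} := (isOpen_lt continuous_const hA).measurableSet
    have hmn : MeasurableSet {z | A z < 0} := (isOpen_lt hA continuous_const).measurableSet
    have hcompl : ∫ z in {z | 0 < A z}ᶜ, k z ∂σ = ∫ z in {z | A z < 0}, k z ∂σ := by
      refine setIntegral_congr_set ?_
      have hae : ∀ᵐ z ∂σ, A z ≠ 0 := by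
        rw [ae_iff]; simpa using toSphere_level (N := N) 0 le_rfl one_pos
      filter_upwards [hae] with z hz
      simp only [eq_iff_iff]
      show ¬ (0 < A z) ↔ A z < 0
      rw [not_lt]
      exact ⟨fun h => lt_of_le_of_ne h hz, le_of_lt⟩
    have hsum := integral_add_compl hmp (hint k hk)
    rw [hcompl, hneg, htot] at hsum
    have hk0 : ∫ z in cap N (Real.pi / 2), (A z ^ 2 - B z ^ 2) ∂σ = 0 := by
      rw [hcapeq]
      show ∫ z in {z | 0 < A z}, k z ∂σ = 0
      linarith
    rw [hsplit, hk0]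
    linarith
  obtain ⟨α, hα, hgα⟩ : ∃ α ∈ Set.Icc a (Real.pi / 2), g α = 0 :=
    intermediate_value_Icc' ha1 (hg.mono fun x hx => ⟨ha0.trans_le hx.1, hx.2⟩) ⟨hgpi, hga⟩
  have hα0 : 0 < α := ha0.trans_le hα.1
  refine ⟨α, hα0, hα.2, ?_⟩
  have hpos : 0 < ∫ z in cap N α, B z ^ 2 ∂σ := by
    rw [setIntegral_pos_iff_support_of_nonneg_ae
      (Filter.Eventually.of_forall fun z => sq_nonneg _) (hint _ (by fun_prop)).integrableOn]
    have hU : IsOpen (Function.support (fun z => B z ^ 2) ∩ cap N α) :=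
      (Continuous.isOpen_support (by fun_prop)).inter (hcapo α)
    refine hU.measure_pos σ ?_
    set t := α / 2 with ht
    have ht0 : 0 < t := by positivity
    have htπ : t < Real.pi := by linarith [hα.2, Real.pi_pos]
    have e21 : inner ℝ (e₂ : E N) e₁ = 0 := by rw [real_inner_comm, inner_e₁_e₂]
    let w : E N := Real.cos t • (e₁ : E N) + Real.sin t • (e₂ : E N)
    have w1 : inner ℝ w e₁ = Real.cos t := by
      simp [w, inner_add_left, inner_smul_left, e21, norm_e₁]
    have w2 : inner ℝ w e₂ = Real.sin t := by
      simp [w, inner_add_left, inner_smul_left, inner_e₁_e₂, norm_e₂]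
    have hw : ‖w‖ = 1 := by
      have : ‖w‖ ^ 2 = 1 := by
        rw [← real_inner_self_eq_norm_sq]
        have : inner ℝ w w = Real.cos t * inner ℝ w e₁ + Real.sin t * inner ℝ w e₂ := by
          conv_lhs => rw [show w = Real.cos t • (e₁ : E N) + Real.sin t • (e₂ : E N) from rfl]
          rw [inner_add_right, inner_smul_right, inner_smul_right]
        rw [this, w1, w2]
        nlinarith [Real.sin_sq_add_cos_sq t]
      nlinarith [norm_nonneg w]
    refine ⟨⟨w, by simpa using hw⟩, ?_, ?_⟩
    · show B _ ^ 2 ≠ 0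
      refine pow_ne_zero _ ?_
      show inner ℝ w e₂ ≠ 0
      rw [w2]
      exact (Real.sin_pos_of_pos_of_lt_pi ht0 htπ).ne'
    · refine (angle_lt_iff _ hα0.le (by linarith [hα.2, Real.pi_pos])).2 ?_
      show Real.cos α < inner ℝ w e₁
      rw [w1]
      exact Real.cos_lt_cos_of_nonneg_of_le_pi ht0.le (by linarith [hα.2, Real.pi_pos])
        (by linarith)
  have heq : g α = (∫ z in cap N α, A z ^ 2 ∂σ) - (p - 1) * ∫ z in cap N α, B z ^ 2 ∂σ := by
    rw [← integral_const_mul,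
      ← integral_sub ((hint _ (by fun_prop)).integrableOn) ((hint _ (by fun_prop)).integrableOn)]
  rw [eq_div_iff hpos.ne']
  rw [hgα] at heq
  simp only [A, B] at heq
  linarith

lemma isApertureAngle_apertureAngle {p : ℝ} (hp : 2 ≤ p) :
    IsApertureAngle N p (apertureAngle N p) :=
  Classical.epsilon_spec (exists_isApertureAngle hp)

end ConeFacts

section Averaging

/-- The constant `C(N,s)`. -/
noncomputable def cNs (N : ℕ) (s : ℝ) : ℝ :=
  4 ^ s * s * Real.Gamma (N / 2 + s) / (Real.pi ^ ((N : ℝ) / 2) * Real.Gamma (1 - s))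

/-- The measure `dμ(z) = C(N,s) |z|^{-N-2s} dz` on `ℝᴺ`. -/
noncomputable def fracMeasure (N : ℕ) (s : ℝ) : Measure (E N) :=
  volume.withDensity fun z => ENNReal.ofReal (cNs N s / ‖z‖ ^ ((N : ℝ) + 2 * s))

variable {N : ℕ} [N.AtLeastTwo]

/-- The average `⨍_{T_p^{ε,∞}(y)} u(x+z) dμ(z)`. -/
noncomputable def coneAverage (p s ε : ℝ) (u : E N → ℝ) (x : E N) (y : S N) : ℝ :=
  ⨍ z in cone p ε (y : E N), u (x + z) ∂(fracMeasure N s)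

/-- The averaging operator `𝓐_ε`. -/
noncomputable def avgOp (p s ε : ℝ) (u : E N → ℝ) (x : E N) : ℝ :=
  ((⨆ y : S N, coneAverage p s ε u x y) + ⨅ y : S N, coneAverage p s ε u x y) / 2

/-- `u` is a bounded Borel solution of the dynamic programming principle `(DPP)_ε` in the
set `D` with the exterior data `F`. -/
structure IsDPPSolution (p s ε : ℝ) (D : Set (E N)) (F u : E N → ℝ) : Prop where
  measurable : Measurable u
  bounded : ∃ C : ℝ, ∀ x, |u x| ≤ C
  eq_avgOp : ∀ x ∈ D, u x = avgOp p s ε u x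
  eq_data : ∀ x ∉ D, u x = F x

end Averaging

section Game

variable {N : ℕ} [N.AtLeastTwo]

/-- The outcomes of one turn: a point of `T_p^{1,∞}` and the outcome of the coin toss, which is
`0` if the direction of Player I is used and `1` if that of Player II is used. -/
abbrev Turn (N : ℕ) [N.AtLeastTwo] (p : ℝ) : Type :=
  ↥(cone p 1 (e₁ : E N)) × Fin 2

/-- The law of one turn: the normalized measure on `T_p^{1,∞}`, times the fair coin. -/
noncomputable def turnMeasure (N : ℕ) [N.AtLeastTwo] (p s : ℝ) : Measure (Turn N p) :=
  ((ProbabilityTheory.cond (fracMeasure N s) (cone p 1 e₁)).comap Subtype.val).prod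
    (ProbabilityTheory.uniformOn Set.univ)

lemma isOpen_cone (p : ℝ) {a : ℝ} (ha : 0 ≤ a) {y : E N} (hy : y ≠ 0) : IsOpen (cone p a y) := by
  have h : ContinuousOn (fun z : E N => InnerProductGeometry.angle y z) {z | a < ‖z‖} := by
    intro z hz
    have hz0 : z ≠ 0 := norm_pos_iff.1 (lt_of_le_of_lt ha hz)
    exact ((InnerProductGeometry.continuousAt_angle (x := (y, z)) hy hz0).comp
      (by fun_prop : ContinuousAt (fun z : E N => (y, z)) z)).continuousWithinAt
  have := h.isOpen_inter_preimage (isOpen_lt continuous_const continuous_norm)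
    (isOpen_Iio (a := apertureAngle N p))
  rwa [Set.inter_comm] at this

/-- For `2 ≤ p` and `0 < s < 1`, the law of one turn is a probability measure. -/
lemma isProbabilityMeasure_turnMeasure {p s : ℝ} (hp : 2 ≤ p) (hs0 : 0 < s) (hs1 : s < 1) :
    IsProbabilityMeasure (turnMeasure N p s) := by
  have he : (e₁ : E N) ≠ 0 := by rw [← norm_ne_zero_iff, norm_e₁]; exact one_ne_zero
  have ho := isOpen_cone (N := N) p zero_le_one he
  have hm := ho.measurableSet
  have hc : 0 < cNs N s := by
    have h1 := Real.Gamma_pos_of_pos (s := (N : ℝ) / 2 + s) (by positivity)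
    have h2 := Real.Gamma_pos_of_pos (s := 1 - s) (by linarith)
    unfold cNs
    positivity
  have hdm : Measurable fun z : E N => ENNReal.ofReal (cNs N s / ‖z‖ ^ ((N : ℝ) + 2 * s)) := by
    fun_prop
  have hpos : fracMeasure N s (cone p 1 e₁) ≠ 0 := by
    rw [fracMeasure, withDensity_apply _ hm]
    refine (setLIntegral_pos_iff hdm |>.2 ?_).ne'
    have hsub : cone p 1 (e₁ : E N) ⊆ Function.support
        (fun z : E N => ENNReal.ofReal (cNs N s / ‖z‖ ^ ((N : ℝ) + 2 * s))) := by
      intro z hz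
      have hz0 : 0 < ‖z‖ := zero_lt_one.trans hz.2
      exact (ENNReal.ofReal_pos.2 (by positivity)).ne'
    rw [Set.inter_eq_right.2 hsub]
    refine ho.measure_pos _ ⟨(2 : ℝ) • e₁, ?_, ?_⟩
    · rw [InnerProductGeometry.angle_smul_right_of_pos _ _ two_pos,
        InnerProductGeometry.angle_self he]
      exact (isApertureAngle_apertureAngle hp).1
    · rw [norm_smul, norm_e₁]; norm_num
  have hfin : fracMeasure N s (cone p 1 e₁) ≠ ⊤ := by
    rw [fracMeasure, withDensity_apply _ hm]
    have hr : (Module.finrank ℝ (E N) : ℝ) < (N : ℝ) + 2 * s := by simp [hs0]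
    have hI := finite_integral_one_add_norm (μ := (volume : Measure (E N))) hr
    have hle : ∫⁻ z in cone p 1 (e₁ : E N),
        ENNReal.ofReal (cNs N s / ‖z‖ ^ ((N : ℝ) + 2 * s)) ≤
        ∫⁻ z : E N, ENNReal.ofReal (cNs N s * 2 ^ ((N : ℝ) + 2 * s)) *
          ENNReal.ofReal ((1 + ‖z‖) ^ (-((N : ℝ) + 2 * s))) := by
      refine (setLIntegral_mono' hm fun z hz => ?_).trans (setLIntegral_le_lintegral _ _)
      have hz1 : 1 < ‖z‖ := hz.2
      have hz0 : 0 < ‖z‖ := zero_lt_one.trans hz1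
      rw [← ENNReal.ofReal_mul (by positivity)]
      refine ENNReal.ofReal_le_ofReal ?_
      rw [Real.rpow_neg (by positivity), ← div_eq_mul_inv, div_le_div_iff₀ (by positivity)
        (by positivity), mul_assoc, ← Real.mul_rpow (by norm_num) hz0.le]
      gcongr
      linarith
    refine (hle.trans_lt ?_).ne
    rw [lintegral_const_mul _ (by fun_prop)]
    exact ENNReal.mul_lt_top ENNReal.ofReal_lt_top hI
  have h1 := ProbabilityTheory.cond_isProbabilityMeasure_of_finite hpos hfin
  have h2 : IsProbabilityMeasure ((ProbabilityTheory.cond (fracMeasure N s)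
      (cone p 1 e₁)).comap (Subtype.val : ↥(cone p 1 (e₁ : E N)) → E N)) := by
    refine ⟨?_⟩
    rw [(MeasurableEmbedding.subtype_coe hm).comap_apply, Set.image_univ, Subtype.range_coe]
    exact ProbabilityTheory.cond_apply_self hpos hfin
  have h3 : IsProbabilityMeasure (ProbabilityTheory.uniformOn (Set.univ : Set (Fin 2))) :=
    ProbabilityTheory.isProbabilityMeasure_uniformOn Set.finite_univ Set.univ_nonempty
  unfold turnMeasure
  infer_instance

/-- The law of an infinite sequence of independent turns (turn number `n` is `ω (n - 1)`). -/
noncomputable def gameMeasure (N : ℕ) [N.AtLeastTwo] (p s : ℝ) : Measure (ℕ → Turn N p) :=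
  Measure.infinitePi fun _ => turnMeasure N p s

/-- The finite histories `H_n = ℝᴺ × (ℝᴺ × Ω₁)ⁿ`: the initial position, then for each of the
turns played the new position together with the outcome of that turn. -/
abbrev History (N : ℕ) [N.AtLeastTwo] (p : ℝ) (n : ℕ) : Type :=
  E N × (Fin n → E N × Turn N p)

/-- The last position recorded in a history. -/
def History.last {p : ℝ} : {n : ℕ} → History N p n → E N
  | 0, h => h.1
  | n + 1, h => (h.2 (Fin.last n)).1

/-- A strategy: Borel choices of a unit vector, one for each length of the history. -/
structure Strategy (N : ℕ) [N.AtLeastTwo] (p : ℝ) where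
  toFun : (n : ℕ) → History N p n → S N
  measurable : ∀ n, Measurable (toFun n)

variable {p : ℝ}

/-- The position after one more turn with outcome `t`, given the history `h`. -/
noncomputable def nextPosition (ε : ℝ) (σI σII : Strategy N p) {n : ℕ} (h : History N p n)
    (t : Turn N p) : E N :=
  h.last + ε • rot (if t.2 = 0 then σI.toFun n h else σII.toFun n h) (t.1 : E N)

/-- The history of the game started at `x` after `n` turns. -/
noncomputable def history (ε : ℝ) (x : E N) (σI σII : Strategy N p) :
    (n : ℕ) → (ℕ → Turn N p) → History N p n
  | 0, _ => (x, Fin.elim0)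
  | n + 1, ω =>
    let h := history ε x σI σII n ω
    (x, Fin.snoc h.2 (nextPosition ε σI σII h (ω n), ω n))

/-- The position `X_n` of the game started at `x`. -/
noncomputable def position (ε : ℝ) (x : E N) (σI σII : Strategy N p) (n : ℕ)
    (ω : ℕ → Turn N p) : E N :=
  (history ε x σI σII n ω).last

/-- The stopping time `τ = min {n ≥ 1 ; X_n ∉ D}`, with value `⊤` if there is no such `n`. -/
noncomputable def exitTime (ε : ℝ) (D : Set (E N)) (x : E N) (σI σII : Strategy N p) :
    (ℕ → Turn N p) → WithTop ℕ :=
  hittingAfter (position ε x σI σII) Dᶜ 1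

/-- The expected payoff `𝔼[F ∘ X_τ]`. -/
noncomputable def expectedPayoff (s ε : ℝ) (D : Set (E N)) (F : E N → ℝ) (x : E N)
    (σI σII : Strategy N p) : ℝ :=
  ∫ ω, F (stoppedValue (position ε x σI σII) (exitTime ε D x σI σII) ω) ∂(gameMeasure N p s)

/-- The game value `u_I^ε(x) = sup_{σ_I} inf_{σ_II} 𝔼[F ∘ X_τ]`. -/
noncomputable def valueI (p s ε : ℝ) (D : Set (E N)) (F : E N → ℝ) (x : E N) : ℝ :=
  ⨆ σI : Strategy N p, ⨅ σII : Strategy N p, expectedPayoff s ε D F x σI σII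

/-- The game value `u_II^ε(x) = inf_{σ_II} sup_{σ_I} 𝔼[F ∘ X_τ]`. -/
noncomputable def valueII (p s ε : ℝ) (D : Set (E N)) (F : E N → ℝ) (x : E N) : ℝ :=
  ⨅ σII : Strategy N p, ⨆ σI : Strategy N p, expectedPayoff s ε D F x σI σII

end Game

end NonlocalTug

/-!
A jump longer than `diam D / ε` leaves `D`, so a jump from `D` stays in `D` with probability at most
some `r < 1`, uniformly in the position and the direction. Hence `𝒜_ε`, applied to functions
with the prescribed values outside `D`, contracts the supremum norm, and `(DPP)_ε` has exactly one
bounded Borel solution `u`. The cone average of a nonnegative function is lower semicontinuous in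
the direction of the cone, so countably many directions suffice in suprema and infima; this yields
that `𝒜_ε u` is Borel and that there are Borel choices of almost optimal directions.

A player who chooses such a direction at every turn makes the worth of the game (`𝒜_ε u` at the
current position while the game runs, then the payoff) a supermartingale up to an error `η` per
turn. The expected number of turns is bounded by a geometric series in `r`, so this player keeps
the expected payoff below `𝒜_ε u(x) + O(η)`; replacing `u` by `-u` gives the bound for the other
player. As `τ ≥ 1`, the value is `𝒜_ε u(x)` at every starting point, also outside `D`.
-/

namespace NonlocalTug

section Minimax

variable {α β γ : Type*} [ConditionallyCompleteLinearOrder γ] [DenselyOrdered γ]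
  [Nonempty α] [Nonempty β] {J : α → β → γ} {V : γ}

lemma ciSup_ciInf_eq_of_almost_optimal (hJ : ∀ a, BddBelow (Set.range (J a)))
    (hI : ∀ w < V, ∃ a, ∀ b, w ≤ J a b) (hII : ∀ w > V, ∃ b, ∀ a, J a b ≤ w) :
    ⨆ a, ⨅ b, J a b = V := by
  refine ciSup_eq_of_forall_le_of_forall_lt_exists_gt (fun a => ?_) fun w hw => ?_
  · refine le_of_forall_gt_imp_ge_of_dense fun w hw => ?_
    obtain ⟨b, hb⟩ := hII w hw
    exact ciInf_le_of_le (hJ a) b (hb a)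
  · obtain ⟨w', hww', hw'⟩ := exists_between hw
    obtain ⟨a, ha⟩ := hI w' hw'
    exact ⟨a, hww'.trans_le (le_ciInf ha)⟩

lemma ciInf_ciSup_eq_of_almost_optimal (hJ : ∀ b, BddAbove (Set.range fun a => J a b))
    (hI : ∀ w < V, ∃ a, ∀ b, w ≤ J a b) (hII : ∀ w > V, ∃ b, ∀ a, J a b ≤ w) :
    ⨅ b, ⨆ a, J a b = V :=
  ciSup_ciInf_eq_of_almost_optimal (γ := γᵒᵈ) (J := fun b a => J a b) hJ hII hI

end Minimax

section BoundedBorel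

variable {X : Type*} [MeasurableSpace X] {u v : X → ℝ}

/-- Bounded Borel functions: the class in which the dynamic programming principle is solved. -/
structure IsBoundedBorel (u : X → ℝ) : Prop where
  measurable : Measurable u
  bounded : ∃ C : ℝ, ∀ x, |u x| ≤ C

namespace IsBoundedBorel

lemma neg (hu : IsBoundedBorel u) : IsBoundedBorel fun x => -u x where
  measurable := hu.measurable.neg
  bounded := by simpa only [abs_neg] using hu.bounded

lemma comp {Y : Type*} [MeasurableSpace Y] {f : Y → X} (hu : IsBoundedBorel u)
    (hf : Measurable f) : IsBoundedBorel fun y => u (f y) where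
  measurable := hu.measurable.comp hf
  bounded := hu.bounded.imp fun _ hC y => hC (f y)

lemma sub (hu : IsBoundedBorel u) (hv : IsBoundedBorel v) :
    IsBoundedBorel fun x => u x - v x where
  measurable := hu.measurable.sub hv.measurable
  bounded := by
    obtain ⟨C, hC⟩ := hu.bounded
    obtain ⟨C', hC'⟩ := hv.bounded
    exact ⟨C + C', fun x => (abs_sub _ _).trans (add_le_add (hC x) (hC' x))⟩

lemma piecewise {A : Set X} [DecidablePred (· ∈ A)] (hu : IsBoundedBorel u)
    (hv : IsBoundedBorel v) (hA : MeasurableSet A) : IsBoundedBorel (A.piecewise u v) where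
  measurable := hu.measurable.piecewise hA hv.measurable
  bounded := by
    obtain ⟨C, hC⟩ := hu.bounded
    obtain ⟨C', hC'⟩ := hv.bounded
    refine ⟨max C C', fun x => ?_⟩
    by_cases hx : x ∈ A
    · simpa only [Set.piecewise_eq_of_mem _ _ _ hx] using (hC x).trans (le_max_left _ _)
    · simpa only [Set.piecewise_eq_of_notMem _ _ _ hx] using (hC' x).trans (le_max_right _ _)

lemma integrable (hu : IsBoundedBorel u) (μ : Measure X) [IsFiniteMeasure μ] :
    Integrable u μ := by
  obtain ⟨C, hC⟩ := hu.bounded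
  exact .of_bound hu.measurable.aestronglyMeasurable C (.of_forall hC)

end IsBoundedBorel

lemma existsUnique_isBoundedBorel_isFixedPt {T : (X → ℝ) → X → ℝ} {r : ℝ} (hr0 : 0 ≤ r)
    (hr1 : r < 1) (hT : ∀ u, IsBoundedBorel u → IsBoundedBorel (T u))
    (hcontr : ∀ u v K, IsBoundedBorel u → IsBoundedBorel v → (∀ x, |u x - v x| ≤ K) →
      ∀ x, |T u x - T v x| ≤ r * K) :
    ∃! u, IsBoundedBorel u ∧ Function.IsFixedPt T u := by
  -- With the discrete topology on `X`, the space `X →ᵇ ℝ` consists of all bounded functions.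
  let _ : TopologicalSpace X := ⊥
  have : DiscreteTopology X := ⟨rfl⟩
  let B := {f : BoundedContinuousFunction X ℝ // Measurable f}
  have hclosed : IsClosed {f : BoundedContinuousFunction X ℝ | Measurable f} :=
    IsSeqClosed.isClosed fun f g hf hfg =>
      measurable_of_tendsto_metrizable hf
        (tendsto_pi_nhds.2 fun x =>
          ((continuous_eval_const x).tendsto g).comp hfg)
  have : CompleteSpace B := hclosed.completeSpace_coe
  have hB (f : B) : IsBoundedBorel f.1 := ⟨f.2, ‖f.1‖, f.1.norm_coe_le_norm⟩
  let ofBorel (u : X → ℝ) (hu : IsBoundedBorel u) : B :=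
    ⟨.ofNormedAddCommGroupDiscrete u hu.bounded.choose hu.bounded.choose_spec, hu.measurable⟩
  let Φ (f : B) : B := ofBorel (T f.1) (hT _ (hB f))
  have hΦ : ContractingWith ⟨r, hr0⟩ Φ := by
    refine ⟨hr1, LipschitzWith.of_dist_le_mul fun f g => ?_⟩
    have hfg (x : X) : dist (f.1 x) (g.1 x) ≤ dist f g :=
      BoundedContinuousFunction.dist_coe_le_dist x
    refine (BoundedContinuousFunction.dist_le (by positivity)).2 ?_
    exact hcontr f.1 g.1 (dist f g) (hB f) (hB g) hfg
  have : Nonempty B := ⟨0, measurable_const⟩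
  refine ⟨hΦ.fixedPoint.1,
    ⟨hB _, congr_arg (fun f : B => (f.1 : X → ℝ)) hΦ.fixedPoint_isFixedPt⟩, ?_⟩
  rintro u ⟨hu, hTu⟩
  have hfix : Function.IsFixedPt Φ (ofBorel u hu) := Subtype.ext (DFunLike.coe_injective hTu)
  exact congr_arg (fun f : B => (f.1 : X → ℝ)) (hΦ.fixedPoint_unique hfix)

end BoundedBorel

section Semicontinuity

variable {X Y Z : Type*} [MeasurableSpace X] [TopologicalSpace Y] [MeasurableSpace Z]

lemma lowerSemicontinuous_setIntegral [FirstCountableTopology Y] {μ : Measure Z} {A : Y → Set Z}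
    {g : Z → ℝ} (hA : ∀ y, MeasurableSet (A y)) (hopen : ∀ z, IsOpen {y | z ∈ A y})
    (hg : ∀ z, 0 ≤ g z) (hgi : ∀ y, IntegrableOn g (A y) μ) :
    LowerSemicontinuous fun y => ∫ z in A y, g z ∂μ := by
  intro y a ha
  have hlim : Filter.Tendsto (fun y' => ∫ z in A y, (A y').indicator g z ∂μ) (nhds y)
      (nhds (∫ z in A y, g z ∂μ)) := by
    refine tendsto_integral_filter_of_dominated_convergence (fun z => ‖g z‖)
      (.of_forall fun y' => (hgi y).aestronglyMeasurable.indicator (hA y'))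
      (.of_forall fun _ => .of_forall fun _ => norm_indicator_le_norm_self _ _) (hgi y).norm ?_
    filter_upwards [ae_restrict_mem (hA y)] with z hz
    refine tendsto_const_nhds.congr' ?_
    filter_upwards [(hopen z).mem_nhds hz] with y' hy'
    exact (Set.indicator_of_mem hy' g).symm
  filter_upwards [hlim.eventually (lt_mem_nhds ha)] with y' hy'
  refine hy'.trans_le ?_
  rw [setIntegral_indicator (hA y')]
  exact setIntegral_mono_set (hgi y') (.of_forall hg) Set.inter_subset_right.eventuallyLE

variable [TopologicalSpace.SeparableSpace Y] [Nonempty Y] {f : X → Y → ℝ}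

lemma lt_ciSup_iff_exists_denseSeq {γ : Type*} [ConditionallyCompleteLinearOrder γ] {g : Y → γ}
    (hl : LowerSemicontinuous g) (hb : BddAbove (Set.range g)) {a : γ} :
    a < ⨆ y, g y ↔ ∃ n, a < g (TopologicalSpace.denseSeq Y n) := by
  refine ⟨fun h => ?_, fun ⟨n, hn⟩ => hn.trans_le (le_ciSup hb _)⟩
  exact (TopologicalSpace.denseRange_denseSeq Y).exists_mem_open (hl.isOpen_preimage a)
    (exists_lt_of_lt_ciSup h)

lemma measurable_ciSup_of_lowerSemicontinuous (hf : ∀ y, Measurable fun x => f x y)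
    (hl : ∀ x, LowerSemicontinuous (f x)) (hb : ∀ x, BddAbove (Set.range (f x))) :
    Measurable fun x => ⨆ y, f x y := by
  refine measurable_of_Ioi fun a => ?_
  simp only [Set.preimage, Set.mem_Ioi, lt_ciSup_iff_exists_denseSeq (hl _) (hb _),
    Set.ofPred_exists]
  exact .iUnion fun n => measurableSet_lt measurable_const (hf _)

lemma exists_measurable_lt_of_lt_ciSup [MeasurableSpace Y] {a : X → ℝ} (ha : Measurable a)
    (hf : ∀ y, Measurable fun x => f x y) (hl : ∀ x, LowerSemicontinuous (f x))
    (hb : ∀ x, BddAbove (Set.range (f x))) (hlt : ∀ x, a x < ⨆ y, f x y) :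
    ∃ φ : X → Y, Measurable φ ∧ ∀ x, a x < f x (φ x) := by
  classical
  have hex x : ∃ n, a x < f x (TopologicalSpace.denseSeq Y n) :=
    (lt_ciSup_iff_exists_denseSeq (hl x) (hb x)).1 (hlt x)
  exact ⟨fun x => TopologicalSpace.denseSeq Y (Nat.find (hex x)),
    measurable_from_nat.comp (measurable_find hex fun _ => measurableSet_lt ha (hf _)),
    fun x => Nat.find_spec (hex x)⟩

end Semicontinuity

section ProductMeasure

variable {ι : Type*} [DecidableEq ι] {X : ι → Type*} [∀ i, MeasurableSpace (X i)]
  (μ : ∀ i, Measure (X i)) [∀ i, IsProbabilityMeasure (μ i)] (i : ι)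

lemma measurePreserving_update_infinitePi :
    MeasurePreserving (fun q : (∀ j, X j) × X i => Function.update q.1 i q.2)
      ((Measure.infinitePi μ).prod (μ i)) (Measure.infinitePi μ) := by
  refine ⟨measurable_update', Measure.eq_infinitePi _ fun I A hA => ?_⟩
  have hpre : (fun q : (∀ j, X j) × X i => Function.update q.1 i q.2) ⁻¹' Set.pi I A =
      Set.pi (I.erase i : Finset ι) A ×ˢ {a | i ∈ I → a ∈ A i} := by
    ext q
    simp only [Set.mem_preimage, Set.mem_pi, Finset.mem_coe, Set.mem_prod, Finset.mem_erase,
      Set.mem_ofPred_eq]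
    grind [Function.update]
  rw [Measure.map_apply measurable_update' (.pi I.countable_toSet fun j _ => hA j), hpre,
    Measure.prod_prod, Measure.infinitePi_pi _ fun j _ => hA j]
  by_cases hi : i ∈ I
  · simp only [hi, forall_const, Set.ofPred_mem_eq]
    exact Finset.prod_erase_mul I _ hi
  · simp [hi]

lemma integral_infinitePi_le_of_integral_update_le {f g : (∀ j, X j) → ℝ}
    (hf : Integrable f (Measure.infinitePi μ)) (hg : Integrable g (Measure.infinitePi μ))
    (h : ∀ ω, ∫ t, f (Function.update ω i t) ∂μ i ≤ g ω) :
    ∫ ω, f ω ∂Measure.infinitePi μ ≤ ∫ ω, g ω ∂Measure.infinitePi μ := by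
  have hupd := measurePreserving_update_infinitePi μ i
  have hfi := hupd.integrable_comp_of_integrable hf
  have hmap := integral_map hupd.measurable.aemeasurable (hupd.map_eq ▸ hf.aestronglyMeasurable)
  rw [hupd.map_eq] at hmap
  rw [hmap]
  refine (integral_prod _ hfi).trans_le ?_
  exact integral_mono hfi.integral_prod_left hg h

end ProductMeasure

open ProbabilityTheory

section Pushforward

variable {α β : Type*} [MeasurableSpace α] [MeasurableSpace β] {μ : Measure α} {φ : α → β}

lemma map_withDensity_comp (hφ : Measurable φ) {f : β → ENNReal} (hf : Measurable f) :
    (μ.withDensity (f ∘ φ)).map φ = (μ.map φ).withDensity f := by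
  ext A hA
  rw [Measure.map_apply hφ hA, withDensity_apply _ (hφ hA), withDensity_apply _ hA,
    setLIntegral_map hA hf hφ]
  rfl

lemma map_cond_preimage (hφ : Measurable φ) {A : Set β} (hA : MeasurableSet A) :
    (μ[|φ ⁻¹' A]).map φ = (μ.map φ)[|A] := by
  rw [ProbabilityTheory.cond, ProbabilityTheory.cond, Measure.map_smul,
    Measure.restrict_map hφ hA, Measure.map_apply hφ hA]

lemma cond_smul_measure {c : ENNReal} (hc : c ≠ 0) (hc' : c ≠ ⊤) (A : Set α) :
    (c • μ)[|A] = μ[|A] := by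
  rw [ProbabilityTheory.cond, ProbabilityTheory.cond, Measure.smul_apply, smul_eq_mul,
    Measure.restrict_smul, smul_smul, ENNReal.mul_inv (.inl hc) (.inl hc'), mul_right_comm,
    ENNReal.inv_mul_cancel hc hc', one_mul]

end Pushforward

section FracMeasure

lemma map_smul_linearIsometryEquiv_volume {V : Type*} [NormedAddCommGroup V]
    [InnerProductSpace ℝ V] [FiniteDimensional ℝ V] [MeasurableSpace V] [BorelSpace V]
    {r : ℝ} (hr : r ≠ 0) (R : V ≃ₗᵢ[ℝ] V) :
    (volume : Measure V).map (fun z => r • R z) =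
      ENNReal.ofReal |(r ^ Module.finrank ℝ V)⁻¹| • volume := by
  rw [← Measure.map_addHaar_smul _ hr, ← R.measurePreserving.map_eq,
    Measure.map_map (measurable_const_smul r) R.continuous.measurable, R.measurePreserving.map_eq]
  rfl

variable {N : ℕ} {p s r : ℝ}

lemma map_smul_linearIsometryEquiv_fracMeasure (s : ℝ) (hr : 0 < r) (R : E N ≃ₗᵢ[ℝ] E N) :
    (fracMeasure N s).map (fun z => r • R z) = ENNReal.ofReal (r ^ (2 * s)) • fracMeasure N s := by
  set k : E N → ENNReal := fun z => ENNReal.ofReal (cNs N s / ‖z‖ ^ ((N : ℝ) + 2 * s)) with hk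
  have hkm : Measurable k := by fun_prop
  set a : ℝ := r ^ ((N : ℝ) + 2 * s) with ha
  have ha0 : 0 < a := Real.rpow_pos_of_pos hr _
  have hscale : k = (ENNReal.ofReal a • k) ∘ fun z => r • R z := by
    funext z
    simp only [hk, Function.comp_apply, Pi.smul_apply, smul_eq_mul, norm_smul, R.norm_map,
      Real.norm_of_nonneg hr.le, Real.mul_rpow hr.le (norm_nonneg z), ← ha,
      ← ENNReal.ofReal_mul ha0.le]
    rw [← div_div, div_right_comm, mul_div_cancel₀ _ ha0.ne']
  have hfactor : |(r ^ N)⁻¹| * a = r ^ (2 * s) := by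
    rw [abs_of_pos (by positivity), ha, Real.rpow_add hr, Real.rpow_natCast,
      inv_mul_cancel_left₀ (by positivity)]
  calc (fracMeasure N s).map (fun z => r • R z)
      = ((volume : Measure (E N)).map fun z => r • R z).withDensity (ENNReal.ofReal a • k) := by
        rw [← map_withDensity_comp (by fun_prop) (hkm.const_smul _), ← hscale, fracMeasure]
    _ = ENNReal.ofReal (|(r ^ N)⁻¹| * a) • fracMeasure N s := by
        rw [map_smul_linearIsometryEquiv_volume hr.ne', finrank_euclideanSpace, Fintype.card_fin,
          withDensity_smul _ hkm, withDensity_smul_measure, smul_smul, mul_comm,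
          ENNReal.ofReal_mul (by positivity), fracMeasure]
    _ = ENNReal.ofReal (r ^ (2 * s)) • fracMeasure N s := by rw [hfactor]

variable [N.AtLeastTwo]

lemma e₁_ne_zero : (e₁ : E N) ≠ 0 := norm_ne_zero_iff.1 (norm_e₁.trans_ne one_ne_zero)

lemma measurableSet_cone (p : ℝ) (hr : 0 ≤ r) {y : E N} (hy : y ≠ 0) :
    MeasurableSet (cone p r y) :=
  (isOpen_cone p hr hy).measurableSet

lemma preimage_smul_rot_cone (p : ℝ) (hr : 0 < r) (y : S N) :
    (fun z => r • rot y z) ⁻¹' cone p r (y : E N) = cone p 1 e₁ := by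
  ext z
  have hangle : InnerProductGeometry.angle (y : E N) (rot y z) =
      InnerProductGeometry.angle e₁ z := by
    rw [← rot_e₁ y]
    exact (rot y).toLinearIsometry.angle_map e₁ z
  simp only [cone, Set.mem_preimage, Set.mem_ofPred_eq,
    InnerProductGeometry.angle_smul_right_of_pos _ _ hr, hangle, norm_smul,
    LinearIsometryEquiv.norm_map, Real.norm_of_nonneg hr.le, lt_mul_iff_one_lt_right hr]

lemma fracMeasure_cone (p s : ℝ) (hr : 0 < r) (y : S N) :
    fracMeasure N s (cone p r (y : E N)) =
      (ENNReal.ofReal (r ^ (2 * s)))⁻¹ * fracMeasure N s (cone p 1 e₁) := by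
  have hc : ENNReal.ofReal (r ^ (2 * s)) ≠ 0 := (ENNReal.ofReal_pos.2 (by positivity)).ne'
  rw [← preimage_smul_rot_cone p hr y, ← Measure.map_apply (by fun_prop)
      (measurableSet_cone p hr.le (ne_zero_of_mem_unit_sphere y)),
    map_smul_linearIsometryEquiv_fracMeasure s hr, Measure.smul_apply, smul_eq_mul,
    ENNReal.inv_mul_cancel_left hc ENNReal.ofReal_ne_top]

end FracMeasure

section JumpLaw

variable {N : ℕ} [N.AtLeastTwo] {p s ε : ℝ}

/-- The law of the jumps before they are scaled and rotated: the normalized fractional measure on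
the cone `T_p^{1,∞}`. -/
noncomputable def jumpLaw (N : ℕ) [N.AtLeastTwo] (p s : ℝ) : Measure (E N) :=
  (fracMeasure N s)[|cone p 1 e₁]

lemma map_jumpLaw (p s : ℝ) (hε : 0 < ε) (y : S N) :
    (jumpLaw N p s).map (fun z => ε • rot y z) = (fracMeasure N s)[|cone p ε (y : E N)] := by
  rw [jumpLaw, ← preimage_smul_rot_cone p hε y, map_cond_preimage (by fun_prop)
      (measurableSet_cone p hε.le (ne_zero_of_mem_unit_sphere y)),
    map_smul_linearIsometryEquiv_fracMeasure s hε,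
    cond_smul_measure (ENNReal.ofReal_pos.2 (by positivity)).ne' ENNReal.ofReal_ne_top]

lemma coneAverage_eq_integral_jumpLaw (p s : ℝ) (hε : 0 < ε) {u : E N → ℝ} (hu : Measurable u)
    (x : E N) (y : S N) :
    coneAverage p s ε u x y = ∫ z, u (x + ε • rot y z) ∂jumpLaw N p s := by
  have hux : Measurable fun z => u (x + z) := by fun_prop
  rw [← integral_map (φ := fun z => ε • rot y z) (by fun_prop) hux.aestronglyMeasurable,
    map_jumpLaw p s hε, coneAverage, setAverage_eq', ProbabilityTheory.cond]

lemma map_comap_jumpLaw (p s : ℝ) :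
    ((jumpLaw N p s).comap ((↑) : cone p 1 (e₁ : E N) → E N)).map (↑) = jumpLaw N p s := by
  have hA : MeasurableSet (cone p 1 (e₁ : E N)) := measurableSet_cone p zero_le_one e₁_ne_zero
  rw [map_comap_subtype_coe hA, jumpLaw, ProbabilityTheory.cond, Measure.restrict_smul,
    Measure.restrict_restrict hA, Set.inter_self]

lemma map_turnMeasure (p s : ℝ) :
    (turnMeasure N p s).map (fun t => (t.1 : E N)) = jumpLaw N p s := by
  have : IsProbabilityMeasure (uniformOn (Set.univ : Set (Fin 2))) :=
    isProbabilityMeasure_uniformOn Set.finite_univ Set.univ_nonempty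
  change (turnMeasure N p s).map (Subtype.val ∘ Prod.fst) = _
  rw [← Measure.map_map measurable_subtype_coe measurable_fst, turnMeasure,
    Measure.map_fst_prod, measure_univ, one_smul]
  exact map_comap_jumpLaw p s

lemma isProbabilityMeasure_jumpLaw (hp : 2 ≤ p) (hs : s ∈ Set.Ioo (0 : ℝ) 1) :
    IsProbabilityMeasure (jumpLaw N p s) := by
  have := isProbabilityMeasure_turnMeasure (N := N) hp hs.1 hs.2
  rw [← map_turnMeasure]
  exact Measure.isProbabilityMeasure_map (by fun_prop)

lemma measurable_rot : Measurable fun q : S N × E N => rot q.1 q.2 := by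
  classical
  have hreflection (v w : E N) : (Submodule.span ℝ {v})ᗮ.reflection w =
      w - (2 * (inner ℝ v w / ‖v‖ ^ 2)) • v := by
    rw [Submodule.reflection_orthogonal_apply, Submodule.reflection_singleton_apply]
    simp [two_mul, two_smul, add_smul]
  have hrot : (fun q : S N × E N => rot q.1 q.2) = fun q =>
      if (q.1 : E N) = -e₁ then
        (Submodule.span ℝ {e₂})ᗮ.reflection ((Submodule.span ℝ {e₁})ᗮ.reflection q.2)
      else
        (Submodule.span ℝ {e₁ + (q.1 : E N)})ᗮ.reflection
          ((Submodule.span ℝ {e₁})ᗮ.reflection q.2) := by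
    funext q
    unfold rot
    split_ifs <;> rfl
  rw [hrot]
  simp only [hreflection]
  exact .ite (measurableSet_eq_fun (by fun_prop) measurable_const) (by fun_prop) (by fun_prop)

variable [IsProbabilityMeasure (jumpLaw N p s)]

instance : IsProbabilityMeasure (turnMeasure N p s) where
  measure_univ := by
    rw [← measure_univ (μ := jumpLaw N p s), ← map_turnMeasure,
      Measure.map_apply (by fun_prop) .univ, Set.preimage_univ]

instance : IsProbabilityMeasure (gameMeasure N p s) := by
  unfold gameMeasure
  infer_instance

variable (p s) in
lemma fracMeasure_cone_ne (hε : 0 < ε) (y : S N) :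
    fracMeasure N s (cone p ε (y : E N)) ≠ ⊤ ∧ fracMeasure N s (cone p ε (y : E N)) ≠ 0 := by
  have hprob : IsProbabilityMeasure ((fracMeasure N s)[|cone p ε (y : E N)]) := by
    rw [← map_jumpLaw p s hε]
    exact Measure.isProbabilityMeasure_map (by fun_prop)
  rw [← not_or, ← cond_eq_zero]
  exact hprob.ne_zero

variable (p s) in
lemma jumpLaw_real_closedBall_lt_one (d : ℝ) :
    (jumpLaw N p s).real (Metric.closedBall 0 d) < 1 := by
  let y : S N := ⟨e₁, by simp [norm_e₁]⟩
  set r := max 1 d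
  have hr : 0 < r := zero_lt_one.trans_le (le_max_left 1 d)
  have hsub : cone p r (y : E N) ⊆ cone p 1 e₁ ∩ (Metric.closedBall 0 d)ᶜ := by
    refine fun z hz => ⟨⟨hz.1, (le_max_left 1 d).trans_lt hz.2⟩, ?_⟩
    rw [Set.mem_compl_iff, mem_closedBall_zero_iff, not_le]
    exact (le_max_right 1 d).trans_lt hz.2
  have hlong : jumpLaw N p s (Metric.closedBall 0 d)ᶜ ≠ 0 := by
    rw [jumpLaw, cond_apply (measurableSet_cone p zero_le_one e₁_ne_zero)]
    refine mul_ne_zero (ENNReal.inv_ne_zero.2 (fracMeasure_cone_ne p s one_pos y).1) fun h => ?_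
    exact (fracMeasure_cone_ne p s hr y).2 (measure_mono_null hsub h)
  have hlong' : 0 < (jumpLaw N p s).real (Metric.closedBall 0 d)ᶜ :=
    ENNReal.toReal_pos hlong (measure_ne_top _ _)
  rw [probReal_compl_eq_one_sub Metric.isClosed_closedBall.measurableSet] at hlong'
  linarith

end JumpLaw

section StayBound

lemma mem_closedBall_of_add_smul_mem {V : Type*} [NormedAddCommGroup V] [NormedSpace ℝ V]
    {A : Set V} (hA : Bornology.IsBounded A) {r : ℝ} (hr : 0 < r) {x z : V} (R : V ≃ₗᵢ[ℝ] V)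
    (hx : x ∈ A) (hz : x + r • R z ∈ A) : z ∈ Metric.closedBall 0 (Metric.diam A / r) := by
  have h := Metric.dist_le_diam_of_mem hA hz hx
  rw [dist_eq_norm, add_sub_cancel_left, norm_smul, R.norm_map, Real.norm_of_nonneg hr.le,
    mul_comm] at h
  rwa [mem_closedBall_zero_iff, le_div_iff₀ hr]

variable {N : ℕ} [N.AtLeastTwo] {p s ε : ℝ} {D : Set (E N)}

/-- An upper bound for the probability that a jump between two points of `D` is possible: the
probability that the scaled jump is not longer than the diameter of `D`. -/
noncomputable def stayBound (p s ε : ℝ) (D : Set (E N)) : ℝ :=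
  (jumpLaw N p s).real (Metric.closedBall 0 (Metric.diam D / ε))

lemma stayBound_nonneg : 0 ≤ stayBound p s ε D := measureReal_nonneg

lemma stayBound_lt_one [IsProbabilityMeasure (jumpLaw N p s)] : stayBound p s ε D < 1 :=
  jumpLaw_real_closedBall_lt_one p s _

end StayBound

section RealInfSup

variable {ι : Sort*} (f : ι → ℝ)

lemma real_iSup_neg : ⨆ i, -f i = -⨅ i, f i := by
  simpa using (Real.mul_iInf_of_nonpos (r := -1) (by norm_num) f).symm

lemma real_iInf_neg : ⨅ i, -f i = -⨆ i, f i := by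
  simpa using (Real.mul_iSup_of_nonpos (r := -1) (by norm_num) f).symm

end RealInfSup

section ConeAverage

variable {N : ℕ} [N.AtLeastTwo] {p s ε : ℝ} {u : E N → ℝ}

instance : Nonempty (S N) := ⟨⟨e₁, by simp [norm_e₁]⟩⟩

lemma isOpen_setOf_mem_cone (p : ℝ) (hε : 0 ≤ ε) (z : E N) :
    IsOpen {y : S N | z ∈ cone p ε (y : E N)} := by
  by_cases hz : ε < ‖z‖
  · have hz0 : z ≠ 0 := norm_pos_iff.1 (hε.trans_lt hz)
    have hangle : Continuous fun y : S N => InnerProductGeometry.angle (y : E N) z :=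
      continuous_iff_continuousAt.2 fun y =>
        (InnerProductGeometry.continuousAt_angle (x := ((y : E N), z))
          (ne_zero_of_mem_unit_sphere y) hz0).comp
          (f := fun y' : S N => ((y' : E N), z)) (by fun_prop)
    simpa only [cone, Set.mem_ofPred_eq, hz, and_true] using
      isOpen_lt hangle continuous_const
  · simp [cone, hz]

lemma coneAverage_neg (p s ε : ℝ) (u : E N → ℝ) (x : E N) (y : S N) :
    coneAverage p s ε (fun z => -u z) x y = -coneAverage p s ε u x y := by
  simp only [coneAverage, average, integral_neg]

lemma avgOp_neg (p s ε : ℝ) (u : E N → ℝ) (x : E N) :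
    avgOp p s ε (fun z => -u z) x = -avgOp p s ε u x := by
  simp only [avgOp, coneAverage_neg, real_iSup_neg, real_iInf_neg]
  ring

variable [IsProbabilityMeasure (jumpLaw N p s)]

lemma integrable_add_smul_rot (hu : IsBoundedBorel u) (ε : ℝ) (x : E N) (y : S N) :
    Integrable (fun z => u (x + ε • rot y z)) (jumpLaw N p s) :=
  (hu.comp (f := fun z => x + ε • rot y z) (by fun_prop)).integrable _

lemma measurable_coneAverage (hε : 0 < ε) (hu : Measurable u) (y : S N) :
    Measurable fun x => coneAverage p s ε u x y := by
  have h : Measurable fun q : E N × E N => u (q.1 + ε • rot y q.2) := by fun_prop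
  simp only [coneAverage_eq_integral_jumpLaw p s hε hu]
  exact h.stronglyMeasurable.integral_prod_right'.measurable

lemma coneAverage_add_const (hε : 0 < ε) (hu : IsBoundedBorel u) (c : ℝ) (x : E N) (y : S N) :
    coneAverage p s ε (fun z => u z + c) x y = coneAverage p s ε u x y + c := by
  rw [coneAverage_eq_integral_jumpLaw p s hε (hu.measurable.add_const c),
    coneAverage_eq_integral_jumpLaw p s hε hu.measurable,
    integral_add (integrable_add_smul_rot hu ε x y) (integrable_const c)]
  simp

lemma abs_coneAverage_le (hε : 0 < ε) (hu : Measurable u) {C : ℝ} (hC : ∀ z, |u z| ≤ C)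
    (x : E N) (y : S N) : |coneAverage p s ε u x y| ≤ C := by
  rw [coneAverage_eq_integral_jumpLaw p s hε hu, ← Real.norm_eq_abs]
  simpa using norm_integral_le_of_norm_le_const (μ := jumpLaw N p s)
    (.of_forall fun z => (Real.norm_eq_abs _).trans_le (hC (x + ε • rot y z)))

lemma bddAbove_range_coneAverage (hε : 0 < ε) (hu : IsBoundedBorel u) (x : E N) :
    BddAbove (Set.range (coneAverage p s ε u x)) := by
  obtain ⟨C, hC⟩ := hu.bounded
  exact ⟨C, Set.forall_mem_range.2 fun y =>
    (abs_le.1 (abs_coneAverage_le hε hu.measurable hC x y)).2⟩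

lemma bddBelow_range_coneAverage (hε : 0 < ε) (hu : IsBoundedBorel u) (x : E N) :
    BddBelow (Set.range (coneAverage p s ε u x)) := by
  obtain ⟨C, hC⟩ := hu.bounded
  exact ⟨-C, Set.forall_mem_range.2 fun y =>
    (abs_le.1 (abs_coneAverage_le hε hu.measurable hC x y)).1⟩

lemma lowerSemicontinuous_coneAverage (hε : 0 < ε) (hu : IsBoundedBorel u) (x : E N) :
    LowerSemicontinuous (coneAverage p s ε u x) := by
  obtain ⟨C, hC⟩ := hu.bounded
  have hpos (z : E N) : 0 ≤ u (x + z) + C := by linarith [(abs_le.1 (hC (x + z))).1]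
  set v : E N → ℝ := fun z => u z + C
  have hv : IsBoundedBorel fun z => v (x + z) :=
    ⟨by have := hu.measurable; fun_prop, 2 * C, fun z => by
      rw [abs_of_nonneg (hpos z)]
      linarith [(abs_le.1 (hC (x + z))).2]⟩
  have hvi (y : S N) : IntegrableOn (fun z => v (x + z)) (cone p ε (y : E N)) (fracMeasure N s) :=
    have : IsFiniteMeasure ((fracMeasure N s).restrict (cone p ε (y : E N))) :=
      isFiniteMeasure_restrict.2 (fracMeasure_cone_ne p s hε y).1
    hv.integrable _
  have hlsc : LowerSemicontinuous (coneAverage p s ε v x) := by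
    have h := lowerSemicontinuous_setIntegral
      (fun y : S N => measurableSet_cone p hε.le (ne_zero_of_mem_unit_sphere y))
      (isOpen_setOf_mem_cone p hε.le) hpos hvi
    unfold coneAverage
    simp only [setAverage_eq, measureReal_def, fracMeasure_cone p s hε]
    exact (continuous_const_smul _).comp_lowerSemicontinuous h
      fun a b hab => smul_le_smul_of_nonneg_left hab (by positivity)
  have hsub : coneAverage p s ε u x = fun y => coneAverage p s ε v x y + -C := by
    funext y
    rw [coneAverage_add_const hε hu, add_neg_cancel_right]
  rw [hsub]
  exact hlsc.add lowerSemicontinuous_const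

lemma exists_measurable_almost_max (hε : 0 < ε) (hu : IsBoundedBorel u) {η : ℝ} (hη : 0 < η) :
    ∃ φ : E N → S N, Measurable φ ∧
      ∀ x, (⨆ y, coneAverage p s ε u x y) - η < coneAverage p s ε u x (φ x) :=
  exists_measurable_lt_of_lt_ciSup
    ((measurable_ciSup_of_lowerSemicontinuous (measurable_coneAverage hε hu.measurable)
      (lowerSemicontinuous_coneAverage hε hu) (bddAbove_range_coneAverage hε hu)).sub_const η)
    (measurable_coneAverage hε hu.measurable) (lowerSemicontinuous_coneAverage hε hu)
    (bddAbove_range_coneAverage hε hu) fun _ => sub_lt_self _ hη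

lemma exists_measurable_almost_min (hε : 0 < ε) (hu : IsBoundedBorel u) {η : ℝ} (hη : 0 < η) :
    ∃ φ : E N → S N, Measurable φ ∧
      ∀ x, coneAverage p s ε u x (φ x) < (⨅ y, coneAverage p s ε u x y) + η := by
  obtain ⟨φ, hφ, h⟩ := exists_measurable_almost_max (p := p) (s := s) hε hu.neg hη
  simp only [coneAverage_neg, real_iSup_neg] at h
  exact ⟨φ, hφ, fun x => by linarith [h x]⟩

end ConeAverage

section AvgOp

variable {N : ℕ} [N.AtLeastTwo] {p s ε : ℝ} {u v : E N → ℝ} {x : E N}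
  [IsProbabilityMeasure (jumpLaw N p s)]

lemma avgOp_le_add (hε : 0 < ε) (hu : IsBoundedBorel u) (hv : IsBoundedBorel v) {K : ℝ}
    (h : ∀ y, coneAverage p s ε u x y ≤ coneAverage p s ε v x y + K) :
    avgOp p s ε u x ≤ avgOp p s ε v x + K := by
  have hsup : ⨆ y, coneAverage p s ε u x y ≤ (⨆ y, coneAverage p s ε v x y) + K :=
    ciSup_le fun y => (h y).trans
      (add_le_add_left (le_ciSup (bddAbove_range_coneAverage hε hv x) y) K)
  have hinf : (⨅ y, coneAverage p s ε u x y) - K ≤ ⨅ y, coneAverage p s ε v x y :=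
    le_ciInf fun y => sub_le_iff_le_add.2
      ((ciInf_le (bddBelow_range_coneAverage hε hu x) y).trans (h y))
  unfold avgOp
  linarith

lemma abs_avgOp_sub_le (hε : 0 < ε) (hu : IsBoundedBorel u) (hv : IsBoundedBorel v) {K : ℝ}
    (h : ∀ y, |coneAverage p s ε u x y - coneAverage p s ε v x y| ≤ K) :
    |avgOp p s ε u x - avgOp p s ε v x| ≤ K := by
  simp only [abs_sub_le_iff, sub_le_iff_le_add'] at h ⊢
  exact ⟨avgOp_le_add hε hu hv fun y => (h y).1, avgOp_le_add hε hv hu fun y => (h y).2⟩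

lemma isBoundedBorel_avgOp (hε : 0 < ε) (hu : IsBoundedBorel u) :
    IsBoundedBorel (avgOp p s ε u) := by
  have hsup {w : E N → ℝ} (hw : IsBoundedBorel w) :
      Measurable fun x => ⨆ y, coneAverage p s ε w x y :=
    measurable_ciSup_of_lowerSemicontinuous (measurable_coneAverage hε hw.measurable)
      (lowerSemicontinuous_coneAverage hε hw) (bddAbove_range_coneAverage hε hw)
  have hinf : Measurable fun x => ⨅ y, coneAverage p s ε u x y := by
    refine measurable_neg_iff.1 ?_
    simpa only [coneAverage_neg, real_iSup_neg] using! hsup hu.neg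
  obtain ⟨C, hC⟩ := hu.bounded
  refine ⟨((hsup hu).add hinf).div_const 2, C, fun x => ?_⟩
  have hzero : IsBoundedBorel fun _ : E N => (0 : ℝ) := ⟨measurable_const, 0, by simp⟩
  have h := abs_avgOp_sub_le (p := p) (s := s) (x := x) (K := C) hε hu hzero fun y => by
    simpa [coneAverage] using abs_coneAverage_le hε hu.measurable hC x y
  simpa [avgOp, coneAverage] using h

lemma abs_coneAverage_sub_le (hε : 0 < ε) {D : Set (E N)} (hD : Bornology.IsBounded D)
    (hx : x ∈ D) (hu : IsBoundedBorel u) (hv : IsBoundedBorel v) {K : ℝ}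
    (hK : ∀ z, |u z - v z| ≤ K) (huv : ∀ z ∉ D, u z = v z) (y : S N) :
    |coneAverage p s ε u x y - coneAverage p s ε v x y| ≤ stayBound p s ε D * K := by
  set B : Set (E N) := Metric.closedBall 0 (Metric.diam D / ε) with hB
  have hBm : MeasurableSet B := Metric.isClosed_closedBall.measurableSet
  have hbound (z : E N) : ‖u (x + ε • rot y z) - v (x + ε • rot y z)‖ ≤
      B.indicator (fun _ => K) z := by
    by_cases hz : z ∈ B
    · simpa only [Set.indicator_of_mem hz] using! hK _
    · have hout : x + ε • rot y z ∉ D := fun h =>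
        hz (mem_closedBall_of_add_smul_mem hD hε (rot y) hx h)
      rw [Set.indicator_of_notMem hz, huv _ hout, sub_self, norm_zero]
  rw [coneAverage_eq_integral_jumpLaw p s hε hu.measurable,
    coneAverage_eq_integral_jumpLaw p s hε hv.measurable, ← integral_sub
      (integrable_add_smul_rot hu ε x y) (integrable_add_smul_rot hv ε x y)]
  refine (norm_integral_le_of_norm_le ((integrable_const K).indicator hBm)
    (.of_forall hbound)).trans_eq ?_
  rw [integral_indicator hBm, setIntegral_const, smul_eq_mul, hB, stayBound]

end AvgOp

section DPP

variable {N : ℕ} [N.AtLeastTwo] {p s ε : ℝ} {D : Set (E N)} {F u v : E N → ℝ}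

lemma IsDPPSolution.isBoundedBorel (hu : IsDPPSolution p s ε D F u) : IsBoundedBorel u :=
  ⟨hu.measurable, hu.bounded⟩

lemma IsDPPSolution.neg (hu : IsDPPSolution p s ε D F u) :
    IsDPPSolution p s ε D (fun x => -F x) fun x => -u x where
  measurable := hu.isBoundedBorel.neg.measurable
  bounded := hu.isBoundedBorel.neg.bounded
  eq_avgOp x hx := by rw [avgOp_neg, hu.eq_avgOp x hx]
  eq_data x hx := by rw [hu.eq_data x hx]

/-- The operator whose fixed points are the solutions of `(DPP)_ε`. Its argument enters only
through its values in `D`, which makes it a contraction on all bounded Borel functions. -/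
noncomputable def dppOp (p s ε : ℝ) (D : Set (E N)) (F u : E N → ℝ) : E N → ℝ :=
  open Classical in
  D.piecewise (avgOp p s ε (D.piecewise u F)) F

lemma isDPPSolution_iff_isFixedPt_dppOp :
    IsDPPSolution p s ε D F u ↔
      IsBoundedBorel u ∧ Function.IsFixedPt (dppOp p s ε D F) u := by
  classical
  have hext (hF : ∀ x ∉ D, u x = F x) : D.piecewise u F = u := by
    funext x
    by_cases hx : x ∈ D
    · rw [Set.piecewise_eq_of_mem _ _ _ hx]
    · rw [Set.piecewise_eq_of_notMem _ _ _ hx, hF x hx]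
  refine ⟨fun h => ⟨h.isBoundedBorel, funext fun x => ?_⟩, fun ⟨hu, hfix⟩ => ?_⟩
  · rw [dppOp, hext h.eq_data]
    by_cases hx : x ∈ D
    · rw [Set.piecewise_eq_of_mem _ _ _ hx, h.eq_avgOp x hx]
    · rw [Set.piecewise_eq_of_notMem _ _ _ hx, h.eq_data x hx]
  · have hF (x) (hx : x ∉ D) : u x = F x := by
      rw [← hfix, dppOp, Set.piecewise_eq_of_notMem _ _ _ hx]
    refine ⟨hu.measurable, hu.bounded, fun x hx => ?_, hF⟩
    conv_lhs => rw [← hfix, dppOp, hext hF, Set.piecewise_eq_of_mem _ _ _ hx]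

variable [IsProbabilityMeasure (jumpLaw N p s)]

lemma isBoundedBorel_dppOp (hε : 0 < ε) (hD : MeasurableSet D) (hF : IsBoundedBorel F)
    (hu : IsBoundedBorel u) : IsBoundedBorel (dppOp p s ε D F u) := by
  classical exact (isBoundedBorel_avgOp hε (hu.piecewise hF hD)).piecewise hF hD

lemma abs_dppOp_sub_le (hε : 0 < ε) (hDm : MeasurableSet D) (hD : Bornology.IsBounded D)
    (hF : IsBoundedBorel F) (hu : IsBoundedBorel u) (hv : IsBoundedBorel v) {K : ℝ}
    (hK : ∀ x, |u x - v x| ≤ K) (x : E N) :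
    |dppOp p s ε D F u x - dppOp p s ε D F v x| ≤ stayBound p s ε D * K := by
  classical
  have hK0 : 0 ≤ K := (abs_nonneg _).trans (hK x)
  by_cases hx : x ∈ D
  · simp only [dppOp, Set.piecewise_eq_of_mem _ _ _ hx]
    refine abs_avgOp_sub_le hε (hu.piecewise hF hDm) (hv.piecewise hF hDm) fun y =>
      abs_coneAverage_sub_le hε hD hx (hu.piecewise hF hDm) (hv.piecewise hF hDm)
        (fun z => ?_) (fun z hz => ?_) y
    · by_cases hz : z ∈ D
      · simpa only [Set.piecewise_eq_of_mem _ _ _ hz] using hK z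
      · simpa only [Set.piecewise_eq_of_notMem _ _ _ hz, sub_self, abs_zero] using hK0
    · simp only [Set.piecewise_eq_of_notMem _ _ _ hz]
  · simp only [dppOp, Set.piecewise_eq_of_notMem _ _ _ hx, sub_self, abs_zero]
    exact mul_nonneg stayBound_nonneg hK0

lemma existsUnique_isDPPSolution (hε : 0 < ε) (hDm : MeasurableSet D)
    (hD : Bornology.IsBounded D) (hF : IsBoundedBorel F) :
    ∃! u, IsDPPSolution p s ε D F u := by
  simp only [isDPPSolution_iff_isFixedPt_dppOp]
  exact existsUnique_isBoundedBorel_isFixedPt stayBound_nonneg stayBound_lt_one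
    (fun u hu => isBoundedBorel_dppOp hε hDm hF hu)
    fun u v K hu hv hK => abs_dppOp_sub_le hε hDm hD hF hu hv hK

end DPP

section Play

variable {N : ℕ} [N.AtLeastTwo] {p : ℝ}

lemma measurable_history_last {n : ℕ} : Measurable (History.last : History N p n → E N) := by
  cases n with
  | zero => exact measurable_fst
  | succ n => exact ((measurable_pi_apply (Fin.last n)).comp measurable_snd).fst

variable (ε : ℝ) (D : Set (E N)) (x : E N) (σI σII : Strategy N p)

lemma measurable_nextPosition (n : ℕ) :
    Measurable fun q : History N p n × Turn N p => nextPosition ε σI σII q.1 q.2 := by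
  have hdir : Measurable fun q : History N p n × Turn N p =>
      if q.2.2 = 0 then σI.toFun n q.1 else σII.toFun n q.1 :=
    .ite (measurable_snd.snd (measurableSet_singleton 0))
      ((σI.measurable n).comp measurable_fst) ((σII.measurable n).comp measurable_fst)
  have hjump : Measurable fun q : History N p n × Turn N p => (q.2.1 : E N) := by fun_prop
  exact (measurable_history_last.comp measurable_fst).add
    ((measurable_rot.comp (hdir.prodMk hjump)).const_smul ε)

lemma measurable_history (n : ℕ) : Measurable (history ε x σI σII n) := by
  induction n with
  | zero => exact measurable_const
  | succ n ih =>
    refine measurable_const.prodMk (measurable_pi_iff.2 (Fin.lastCases ?_ fun j => ?_))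
    · simp only [Fin.snoc_last]
      exact ((measurable_nextPosition ε σI σII n).comp (ih.prodMk (measurable_pi_apply n))).prodMk
        (measurable_pi_apply n)
    · simp only [Fin.snoc_castSucc]
      exact (measurable_pi_apply j).comp ih.snd

lemma measurable_position (n : ℕ) : Measurable (position ε x σI σII n) :=
  measurable_history_last.comp (measurable_history ε x σI σII n)

lemma position_succ (n : ℕ) (ω : ℕ → Turn N p) :
    position ε x σI σII (n + 1) ω = nextPosition ε σI σII (history ε x σI σII n ω) (ω n) := by
  simp [position, history, History.last]

lemma history_update (ω : ℕ → Turn N p) (t : Turn N p) {m n : ℕ} (hmn : m ≤ n) :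
    history ε x σI σII m (Function.update ω n t) = history ε x σI σII m ω := by
  induction m with
  | zero => rfl
  | succ m ih => simp only [history, ih (by omega), Function.update_of_ne (by omega : m ≠ n)]

lemma position_update (ω : ℕ → Turn N p) (t : Turn N p) {m n : ℕ} (hmn : m ≤ n) :
    position ε x σI σII m (Function.update ω n t) = position ε x σI σII m ω := by
  rw [position, history_update ε x σI σII ω t hmn, position]

lemma measurable_stoppedValue_position (hD : MeasurableSet D) :
    Measurable (stoppedValue (position ε x σI σII) (exitTime ε D x σI σII)) := by
  let ℱ : Filtration ℕ (MeasurableSpace.pi : MeasurableSpace (ℕ → Turn N p)) :=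
    Filtration.const ℕ _ le_rfl
  have hX (n : ℕ) : Measurable (position ε x σI σII n) := measurable_position ε x σI σII n
  have hτ : IsStoppingTime ℱ (exitTime ε D x σI σII) :=
    Adapted.isStoppingTime_hittingAfter (f := ℱ) hX hD.compl
  have hadapted : StronglyAdapted ℱ (position ε x σI σII) := fun n => (hX n).stronglyMeasurable
  exact (measurable_stoppedValue hadapted.isStronglyProgressive_of_discrete hτ).mono
    hτ.measurableSpace_le le_rfl

/-- The event that the game is still running after `n` turns, that is `τ > n`. The starting
position is not tested, since the exit time is at least `1`. -/
def alive (n : ℕ) : Set (ℕ → Turn N p) :=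
  {ω | ∀ k, 1 ≤ k → k ≤ n → position ε x σI σII k ω ∈ D}

lemma measurableSet_alive (hD : MeasurableSet D) (n : ℕ) :
    MeasurableSet (alive ε D x σI σII n) := by
  simp only [alive, Set.ofPred_forall]
  exact .iInter fun k => .iInter fun _ => .iInter fun _ => measurable_position ε x σI σII k hD

lemma alive_zero : alive ε D x σI σII 0 = Set.univ :=
  Set.eq_univ_of_forall fun _ k hk hk' => by omega

lemma mem_alive_succ_iff {n : ℕ} {ω : ℕ → Turn N p} : ω ∈ alive ε D x σI σII (n + 1) ↔
    ω ∈ alive ε D x σI σII n ∧ position ε x σI σII (n + 1) ω ∈ D := by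
  refine ⟨fun h => ⟨fun k hk hkn => h k hk (by omega), h _ (by omega) le_rfl⟩,
    fun ⟨h, hn⟩ k hk hkn => ?_⟩
  rcases hkn.lt_or_eq with hlt | rfl
  · exact h k hk (by omega)
  · exact hn

lemma update_mem_alive_iff (n : ℕ) (ω : ℕ → Turn N p) (t : Turn N p) :
    Function.update ω n t ∈ alive ε D x σI σII n ↔ ω ∈ alive ε D x σI σII n := by
  refine forall_congr' fun k => forall_congr' fun _ => forall_congr' fun hk => ?_
  rw [position_update ε x σI σII ω t hk]

variable {ε D x σI σII}

lemma stoppedValue_of_mem_alive_of_notMem {n : ℕ} {ω : ℕ → Turn N p}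
    (h : ω ∈ alive ε D x σI σII n) (hexit : position ε x σI σII (n + 1) ω ∉ D) :
    stoppedValue (position ε x σI σII) (exitTime ε D x σI σII) ω =
      position ε x σI σII (n + 1) ω := by
  have hle : exitTime ε D x σI σII ω ≤ WithTop.some (n + 1) :=
    hittingAfter_le_of_mem (Nat.le_add_left 1 n) hexit
  have hge : ¬ exitTime ε D x σI σII ω < WithTop.some (n + 1) := by
    rw [exitTime, hittingAfter_lt_iff]
    rintro ⟨j, hj, hjD⟩
    exact hjD (h j hj.1 (Nat.lt_succ_iff.1 hj.2))
  rw [stoppedValue, hle.antisymm (not_lt.1 hge)]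
  rfl

end Play

section Length

variable {N : ℕ} [N.AtLeastTwo] {p s ε : ℝ} {D : Set (E N)}
  [IsProbabilityMeasure (jumpLaw N p s)]

lemma measureReal_alive_succ_le (hε : 0 < ε) (hD : Bornology.IsBounded D) (x : E N)
    (σI σII : Strategy N p) (n : ℕ) :
    (gameMeasure N p s).real (alive ε D x σI σII (n + 1)) ≤ stayBound p s ε D ^ n := by
  set B : Set (E N) := Metric.closedBall 0 (Metric.diam D / ε)
  have hBm : MeasurableSet B := Metric.isClosed_closedBall.measurableSet
  set short : Set (Turn N p) := (fun t => (t.1 : E N)) ⁻¹' B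
  have hshort : MeasurableSet short := measurable_subtype_coe.comp measurable_fst hBm
  have hsub : alive ε D x σI σII (n + 1) ⊆ Set.pi (Finset.Icc 1 n : Finset ℕ) fun _ => short := by
    intro ω hω k hk
    rw [Finset.mem_coe, Finset.mem_Icc] at hk
    have hnext := hω (k + 1) (by omega) (by omega)
    rw [position_succ] at hnext
    exact mem_closedBall_of_add_smul_mem hD hε _ (hω k hk.1 (by omega)) hnext
  calc (gameMeasure N p s).real (alive ε D x σI σII (n + 1))
      ≤ (gameMeasure N p s).real (Set.pi (Finset.Icc 1 n : Finset ℕ) fun _ => short) :=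
        measureReal_mono hsub
    _ = (turnMeasure N p s).real short ^ n := by
        simp only [measureReal_def, gameMeasure, Measure.infinitePi_pi _ fun _ _ => hshort,
          Finset.prod_const, Nat.card_Icc, ENNReal.toReal_pow, add_tsub_cancel_right]
    _ = stayBound p s ε D ^ n := by
        rw [stayBound, ← map_turnMeasure, map_measureReal_apply (by fun_prop) hBm]

lemma sum_measureReal_alive_le (hε : 0 < ε) (hD : Bornology.IsBounded D) (x : E N)
    (σI σII : Strategy N p) (n : ℕ) :
    ∑ k ∈ Finset.range n, (gameMeasure N p s).real (alive ε D x σI σII k) ≤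
      1 + (1 - stayBound p s ε D)⁻¹ := by
  calc ∑ k ∈ Finset.range n, (gameMeasure N p s).real (alive ε D x σI σII k)
      ≤ ∑ k ∈ Finset.range (n + 1), (gameMeasure N p s).real (alive ε D x σI σII k) :=
        Finset.sum_le_sum_of_subset_of_nonneg (Finset.range_mono n.le_succ)
          fun _ _ _ => measureReal_nonneg
    _ ≤ ∑ k ∈ Finset.range n, stayBound p s ε D ^ k + 1 := by
        rw [Finset.sum_range_succ']
        gcongr with k
        · exact measureReal_alive_succ_le hε hD x σI σII k
        · exact measureReal_le_one
    _ ≤ 1 + (1 - stayBound p s ε D)⁻¹ := by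
        rw [add_comm, ← tsum_geometric_of_lt_one stayBound_nonneg stayBound_lt_one]
        gcongr
        exact (summable_geometric_of_lt_one stayBound_nonneg stayBound_lt_one).sum_le_tsum _
          fun _ _ => pow_nonneg stayBound_nonneg _

lemma tendsto_measureReal_alive (hε : 0 < ε) (hD : Bornology.IsBounded D) (x : E N)
    (σI σII : Strategy N p) :
    Filter.Tendsto (fun n => (gameMeasure N p s).real (alive ε D x σI σII n)) Filter.atTop
      (nhds 0) :=
  (Filter.tendsto_add_atTop_iff_nat 1).1 <|
    squeeze_zero (fun _ => measureReal_nonneg) (measureReal_alive_succ_le hε hD x σI σII)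
      (tendsto_pow_atTop_nhds_zero_of_lt_one stayBound_nonneg stayBound_lt_one)

end Length

section OneTurn

variable {N : ℕ} [N.AtLeastTwo] {p s ε : ℝ} {u : E N → ℝ}
  [IsProbabilityMeasure (jumpLaw N p s)]

lemma integral_nextPosition (hε : 0 < ε) (hu : IsBoundedBorel u) (σI σII : Strategy N p) {n : ℕ}
    (h : History N p n) :
    ∫ t, u (nextPosition ε σI σII h t) ∂turnMeasure N p s =
      (coneAverage p s ε u h.last (σI.toFun n h) +
        coneAverage p s ε u h.last (σII.toFun n h)) / 2 := by
  have : IsProbabilityMeasure (ProbabilityTheory.uniformOn (Set.univ : Set (Fin 2))) :=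
    ProbabilityTheory.isProbabilityMeasure_uniformOn Set.finite_univ Set.univ_nonempty
  have hhalf (i : Fin 2) :
      (ProbabilityTheory.uniformOn (Set.univ : Set (Fin 2))).real {i} = 1 / 2 := by
    simp [measureReal_def, ProbabilityTheory.uniformOn_univ]
  set ν := (jumpLaw N p s).comap ((↑) : cone p 1 (e₁ : E N) → E N) with hν
  have hνfin : IsFiniteMeasure ν := by
    have h : IsFiniteMeasure (ν.map ((↑) : cone p 1 (e₁ : E N) → E N)) := by
      rw [hν, map_comap_jumpLaw]
      infer_instance
    exact Measure.isFiniteMeasure_of_map measurable_subtype_coe.aemeasurable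
  have hjump (y : S N) :
      ∫ z, u (h.last + ε • rot y (z : E N)) ∂ν = coneAverage p s ε u h.last y := by
    have hm : Measurable fun z => u (h.last + ε • rot y z) := by
      have := hu.measurable
      fun_prop
    rw [coneAverage_eq_integral_jumpLaw p s hε hu.measurable, ← map_comap_jumpLaw p s,
      integral_map (by fun_prop) hm.aestronglyMeasurable]
  have hint : Integrable (fun t => u (nextPosition ε σI σII h t))
      (ν.prod (ProbabilityTheory.uniformOn Set.univ)) :=
    (hu.comp ((measurable_nextPosition ε σI σII n).comp
      (measurable_const.prodMk measurable_id))).integrable _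
  change ∫ t, _ ∂ν.prod (ProbabilityTheory.uniformOn Set.univ) = _
  rw [integral_prod_symm _ hint, integral_fintype Integrable.of_finite, Fin.sum_univ_two, hhalf,
    hhalf]
  simp only [nextPosition, if_true, one_ne_zero, if_false, hjump, smul_eq_mul]
  ring

end OneTurn

section InterimPayoff

variable {N : ℕ} [N.AtLeastTwo] {p s ε : ℝ} {D : Set (E N)} {F u : E N → ℝ}

/-- What the game is worth after `n` turns according to the solution `u` of `(DPP)_ε`: the average
of `u` at the current position while the game is running, and the payoff once it has stopped. -/
noncomputable def interimPayoff (s ε : ℝ) (D : Set (E N)) (F u : E N → ℝ) (x : E N)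
    (σI σII : Strategy N p) (n : ℕ) : (ℕ → Turn N p) → ℝ :=
  open Classical in
  (alive ε D x σI σII n).piecewise (fun ω => avgOp p s ε u (position ε x σI σII n ω))
    fun ω => F (stoppedValue (position ε x σI σII) (exitTime ε D x σI σII) ω)

lemma interimPayoff_zero (x : E N) (σI σII : Strategy N p) (ω : ℕ → Turn N p) :
    interimPayoff s ε D F u x σI σII 0 ω = avgOp p s ε u x := by
  simp [interimPayoff, alive_zero, position, history, History.last]

lemma IsDPPSolution.interimPayoff_succ (hu : IsDPPSolution p s ε D F u) (x : E N)
    (σI σII : Strategy N p) (n : ℕ) (ω : ℕ → Turn N p) :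
    interimPayoff s ε D F u x σI σII (n + 1) ω = interimPayoff s ε D F u x σI σII n ω +
      (alive ε D x σI σII n).indicator (fun ω => u (position ε x σI σII (n + 1) ω) -
        avgOp p s ε u (position ε x σI σII n ω)) ω := by
  by_cases h : ω ∈ alive ε D x σI σII n
  · by_cases hD : position ε x σI σII (n + 1) ω ∈ D
    · simp [interimPayoff, mem_alive_succ_iff, h, hD, hu.eq_avgOp]
    · simp [interimPayoff, mem_alive_succ_iff, h, hD, hu.eq_data,
        stoppedValue_of_mem_alive_of_notMem h hD]
  · simp [interimPayoff, mem_alive_succ_iff, h]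

variable [IsProbabilityMeasure (jumpLaw N p s)]

lemma isBoundedBorel_payoff (hD : MeasurableSet D) (hF : IsBoundedBorel F) (x : E N)
    (σI σII : Strategy N p) :
    IsBoundedBorel fun ω => F (stoppedValue (position ε x σI σII) (exitTime ε D x σI σII) ω) :=
  hF.comp (measurable_stoppedValue_position ε D x σI σII hD)

lemma isBoundedBorel_interimPayoff (hε : 0 < ε) (hD : MeasurableSet D) (hF : IsBoundedBorel F)
    (hu : IsBoundedBorel u) (x : E N) (σI σII : Strategy N p) (n : ℕ) :
    IsBoundedBorel (interimPayoff s ε D F u x σI σII n) := by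
  classical
  exact ((isBoundedBorel_avgOp hε hu).comp (measurable_position ε x σI σII n)).piecewise
    (isBoundedBorel_payoff hD hF x σI σII) (measurableSet_alive ε D x σI σII hD n)

lemma isBoundedBorel_position_succ_sub_avgOp (hε : 0 < ε) (hu : IsBoundedBorel u) (x : E N)
    (σI σII : Strategy N p) (n : ℕ) : IsBoundedBorel fun ω =>
      u (position ε x σI σII (n + 1) ω) - avgOp p s ε u (position ε x σI σII n ω) :=
  (hu.comp (measurable_position ε x σI σII (n + 1))).sub
    ((isBoundedBorel_avgOp hε hu).comp (measurable_position ε x σI σII n))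

lemma tendsto_integral_interimPayoff (hε : 0 < ε) (hDm : MeasurableSet D)
    (hD : Bornology.IsBounded D) (hF : IsBoundedBorel F) (hu : IsBoundedBorel u) (x : E N)
    (σI σII : Strategy N p) :
    Filter.Tendsto (fun n => ∫ ω, interimPayoff s ε D F u x σI σII n ω ∂gameMeasure N p s)
      Filter.atTop (nhds (expectedPayoff s ε D F x σI σII)) := by
  obtain ⟨A, hA⟩ := (isBoundedBorel_avgOp (p := p) (s := s) hε hu).bounded
  obtain ⟨B, hB⟩ := hF.bounded
  have hpay := isBoundedBorel_payoff (ε := ε) hDm hF x σI σII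
  have hdiff (n : ℕ) (ω : ℕ → Turn N p) : ‖interimPayoff s ε D F u x σI σII n ω -
      F (stoppedValue (position ε x σI σII) (exitTime ε D x σI σII) ω)‖ ≤
        (alive ε D x σI σII n).indicator (fun _ => A + B) ω := by
    by_cases h : ω ∈ alive ε D x σI σII n
    · simpa [interimPayoff, h] using (abs_sub _ _).trans (add_le_add (hA _) (hB _))
    · simp [interimPayoff, h]
  refine tendsto_iff_norm_sub_tendsto_zero.2 (squeeze_zero (fun _ => norm_nonneg _) (fun n => ?_)
    (by simpa using (tendsto_measureReal_alive (p := p) (s := s) hε hD x σI σII).mul_const (A + B)))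
  have halive := measurableSet_alive ε D x σI σII hDm n
  rw [expectedPayoff, ← integral_sub
    ((isBoundedBorel_interimPayoff hε hDm hF hu x σI σII n).integrable _) (hpay.integrable _)]
  refine (norm_integral_le_of_norm_le ((integrable_const _).indicator halive)
    (.of_forall (hdiff n))).trans_eq ?_
  rw [integral_indicator halive, setIntegral_const, smul_eq_mul]

variable {η : ℝ} {σI σII : Strategy N p}

lemma setIntegral_alive_le (hε : 0 < ε) (hD : MeasurableSet D) (hu : IsBoundedBorel u)
    (hσ : ∀ n (h : History N p n), ∫ t, u (nextPosition ε σI σII h t) ∂turnMeasure N p s ≤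
      avgOp p s ε u h.last + η) (x : E N) (n : ℕ) :
    ∫ ω in alive ε D x σI σII n,
        (u (position ε x σI σII (n + 1) ω) - avgOp p s ε u (position ε x σI σII n ω))
          ∂gameMeasure N p s ≤
      η * (gameMeasure N p s).real (alive ε D x σI σII n) := by
  have halive := measurableSet_alive ε D x σI σII hD n
  have hgain := isBoundedBorel_position_succ_sub_avgOp (p := p) (s := s) hε hu x σI σII n
  rw [← integral_indicator halive, mul_comm, ← smul_eq_mul, ← setIntegral_const,
    ← integral_indicator halive]
  refine integral_infinitePi_le_of_integral_update_le _ n ((hgain.integrable _).indicator halive)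
    ((integrable_const _).indicator halive) fun ω => ?_
  by_cases h : ω ∈ alive ε D x σI σII n
  · have hint : Integrable (fun t => u (nextPosition ε σI σII (history ε x σI σII n ω) t))
        (turnMeasure N p s) :=
      (hu.comp ((measurable_nextPosition ε σI σII n).comp
        (measurable_const.prodMk measurable_id))).integrable _
    simp only [Set.indicator, update_mem_alive_iff, h, if_true, position_succ,
      position_update ε x σI σII ω _ le_rfl, history_update ε x σI σII ω _ le_rfl,
      Function.update_self]
    rw [integral_sub hint (integrable_const _), integral_const, probReal_univ, one_smul,
      sub_le_iff_le_add']
    exact hσ n _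
  · simp [Set.indicator, update_mem_alive_iff, h]

lemma IsDPPSolution.integral_interimPayoff_le (hu : IsDPPSolution p s ε D F u) (hε : 0 < ε)
    (hD : MeasurableSet D) (hF : IsBoundedBorel F)
    (hσ : ∀ n (h : History N p n), ∫ t, u (nextPosition ε σI σII h t) ∂turnMeasure N p s ≤
      avgOp p s ε u h.last + η) (x : E N) (n : ℕ) :
    ∫ ω, interimPayoff s ε D F u x σI σII n ω ∂gameMeasure N p s ≤ avgOp p s ε u x +
      η * ∑ k ∈ Finset.range n, (gameMeasure N p s).real (alive ε D x σI σII k) := by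
  induction n with
  | zero => simp [interimPayoff_zero]
  | succ n ih =>
    have hub := hu.isBoundedBorel
    have hgain := (isBoundedBorel_position_succ_sub_avgOp (p := p) (s := s) hε hub x σI σII
      n).integrable (gameMeasure N p s)
    have halive := measurableSet_alive ε D x σI σII hD n
    simp only [hu.interimPayoff_succ]
    rw [integral_add ((isBoundedBorel_interimPayoff hε hD hF hub x σI σII n).integrable _)
      (hgain.indicator halive), integral_indicator halive, Finset.sum_range_succ, mul_add,
      ← add_assoc]
    exact add_le_add ih (setIntegral_alive_le hε hD hub hσ x n)

lemma IsDPPSolution.expectedPayoff_le (hu : IsDPPSolution p s ε D F u) (hε : 0 < ε)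
    (hDm : MeasurableSet D) (hD : Bornology.IsBounded D) (hF : IsBoundedBorel F) (hη : 0 ≤ η)
    (hσ : ∀ n (h : History N p n), ∫ t, u (nextPosition ε σI σII h t) ∂turnMeasure N p s ≤
      avgOp p s ε u h.last + η) (x : E N) :
    expectedPayoff s ε D F x σI σII ≤
      avgOp p s ε u x + η * (1 + (1 - stayBound p s ε D)⁻¹) :=
  le_of_tendsto' (tendsto_integral_interimPayoff hε hDm hD hF hu.isBoundedBorel x σI σII)
    fun n => (hu.integral_interimPayoff_le hε hDm hF hσ x n).trans <| by
      gcongr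
      exact sum_measureReal_alive_le hε hD x σI σII n

end InterimPayoff

section Value

variable {N : ℕ} [N.AtLeastTwo] {p s ε : ℝ} {D : Set (E N)} {F u : E N → ℝ}

/-- The stationary strategy that chooses a direction depending only on the current position. -/
def Strategy.ofPosition (φ : E N → S N) (hφ : Measurable φ) : Strategy N p where
  toFun _ h := φ h.last
  measurable _ := hφ.comp measurable_history_last

instance : Nonempty (Strategy N p) :=
  ⟨.ofPosition (fun _ => Classical.arbitrary _) measurable_const⟩

lemma expectedPayoff_neg (s ε : ℝ) (D : Set (E N)) (F : E N → ℝ) (x : E N)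
    (σI σII : Strategy N p) :
    expectedPayoff s ε D (fun z => -F z) x σI σII = -expectedPayoff s ε D F x σI σII := by
  simp only [expectedPayoff, integral_neg]

variable [IsProbabilityMeasure (jumpLaw N p s)]

lemma abs_expectedPayoff_le {C : ℝ} (hC : ∀ x, |F x| ≤ C) (x : E N) (σI σII : Strategy N p) :
    |expectedPayoff s ε D F x σI σII| ≤ C := by
  simpa [expectedPayoff] using norm_integral_le_of_norm_le_const (μ := gameMeasure N p s)
    (f := fun ω => F (stoppedValue (position ε x σI σII) (exitTime ε D x σI σII) ω))
    (.of_forall fun ω => hC _)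

lemma IsDPPSolution.exists_forall_expectedPayoff_le (hu : IsDPPSolution p s ε D F u) (hε : 0 < ε)
    (hDm : MeasurableSet D) (hD : Bornology.IsBounded D) (hF : IsBoundedBorel F) {x : E N} {c : ℝ}
    (hc : avgOp p s ε u x < c) :
    ∃ σ : Strategy N p, ∀ σ', expectedPayoff s ε D F x σ σ' ≤ c ∧
      expectedPayoff s ε D F x σ' σ ≤ c := by
  have hr : stayBound p s ε D < 1 := stayBound_lt_one
  have hK : 0 < 1 + (1 - stayBound p s ε D)⁻¹ := add_pos one_pos (inv_pos.2 (sub_pos.2 hr))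
  set η := (c - avgOp p s ε u x) / (1 + (1 - stayBound p s ε D)⁻¹) with hη
  have hη0 : 0 < η := div_pos (sub_pos.2 hc) hK
  have hub := hu.isBoundedBorel
  obtain ⟨φ, hφ, hmin⟩ := exists_measurable_almost_min (p := p) (s := s) hε hub hη0
  have hmean (n) (h : History N p n) (y : S N) :
      (coneAverage p s ε u h.last (φ h.last) + coneAverage p s ε u h.last y) / 2 ≤
        avgOp p s ε u h.last + η := by
    have hmax := le_ciSup (bddAbove_range_coneAverage (p := p) (s := s) hε hub h.last) y
    unfold avgOp
    linarith [hmin h.last]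
  have hpayoff {σI σII : Strategy N p} (hσ : ∀ n (h : History N p n),
      (coneAverage p s ε u h.last (σI.toFun n h) + coneAverage p s ε u h.last (σII.toFun n h)) / 2 ≤
        avgOp p s ε u h.last + η) : expectedPayoff s ε D F x σI σII ≤ c :=
    calc expectedPayoff s ε D F x σI σII
        ≤ avgOp p s ε u x + η * (1 + (1 - stayBound p s ε D)⁻¹) :=
          hu.expectedPayoff_le hε hDm hD hF hη0.le
            (fun n h => (integral_nextPosition hε hub σI σII h).trans_le (hσ n h)) x
      _ = c := by rw [hη, div_mul_cancel₀ _ hK.ne', add_sub_cancel]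
  exact ⟨.ofPosition φ hφ, fun σ' => ⟨hpayoff fun n h => hmean n h _,
    hpayoff fun n h => by rw [add_comm (coneAverage _ _ _ _ _ _)]; exact hmean n h _⟩⟩

lemma IsDPPSolution.value_eq (hu : IsDPPSolution p s ε D F u) (hε : 0 < ε)
    (hDm : MeasurableSet D) (hD : Bornology.IsBounded D) (hF : IsBoundedBorel F) (x : E N) :
    valueI p s ε D F x = avgOp p s ε u x ∧ valueII p s ε D F x = avgOp p s ε u x := by
  have hI (c) (hc : c < avgOp p s ε u x) :
      ∃ σI : Strategy N p, ∀ σII, c ≤ expectedPayoff s ε D F x σI σII := by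
    rw [← neg_lt_neg_iff, ← avgOp_neg] at hc
    obtain ⟨σ, hσ⟩ := hu.neg.exists_forall_expectedPayoff_le hε hDm hD hF.neg hc
    exact ⟨σ, fun σII => neg_le_neg_iff.1 (expectedPayoff_neg s ε D F x σ σII ▸ (hσ σII).1)⟩
  have hII (c) (hc : c > avgOp p s ε u x) :
      ∃ σII : Strategy N p, ∀ σI, expectedPayoff s ε D F x σI σII ≤ c :=
    (hu.exists_forall_expectedPayoff_le hε hDm hD hF hc).imp fun _ hσ σI => (hσ σI).2
  obtain ⟨C, hC⟩ := hF.bounded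
  have hbound (σI σII : Strategy N p) : |expectedPayoff s ε D F x σI σII| ≤ C :=
    abs_expectedPayoff_le hC x σI σII
  exact ⟨ciSup_ciInf_eq_of_almost_optimal
      (fun σI => ⟨-C, Set.forall_mem_range.2 fun σII => (abs_le.1 (hbound σI σII)).1⟩) hI hII,
    ciInf_ciSup_eq_of_almost_optimal
      (fun σII => ⟨C, Set.forall_mem_range.2 fun σI => (abs_le.1 (hbound σI σII)).2⟩) hI hII⟩

end Value

end NonlocalTug

theorem lemma7p1_general (N : ℕ) [N.AtLeastTwo] (p s : ℝ) (hp : 2 ≤ p)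
    (hs : s ∈ Set.Ioo (0 : ℝ) 1) (D : Set (NonlocalTug.E N)) (hDm : MeasurableSet D)
    (hDb : Bornology.IsBounded D) (F : NonlocalTug.E N → ℝ) (hFb : ∃ C : ℝ, ∀ x, |F x| ≤ C)
    (hFm : Measurable F) (ε : ℝ) (hε : 0 < ε) :
    ∃ u : NonlocalTug.E N → ℝ,
      NonlocalTug.IsDPPSolution p s ε D F u ∧
      (∀ v, NonlocalTug.IsDPPSolution p s ε D F v → v = u) ∧
      ∀ x, NonlocalTug.valueI p s ε D F x = NonlocalTug.avgOp p s ε u x ∧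
        NonlocalTug.valueII p s ε D F x = NonlocalTug.avgOp p s ε u x := by
  have := NonlocalTug.isProbabilityMeasure_jumpLaw (N := N) hp hs
  have hF : NonlocalTug.IsBoundedBorel F := ⟨hFm, hFb⟩
  obtain ⟨u, hu, huniq⟩ :=
    NonlocalTug.existsUnique_isDPPSolution (p := p) (s := s) hε hDm hDb hF
  exact ⟨u, hu, huniq, hu.value_eq hε hDm hDb hF⟩

theorem lemma7p1 (N : ℕ) [N.AtLeastTwo] (p s : ℝ) (hp : 2 ≤ p) (hs : s ∈ Set.Ioo (1 / 2 : ℝ) 1)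
    (D : Set (NonlocalTug.E N)) (hDo : IsOpen D) (hDb : Bornology.IsBounded D)
    (F : NonlocalTug.E N → ℝ) (hFb : ∃ C : ℝ, ∀ x, |F x| ≤ C) (hFc : UniformContinuous F)
    (ε : ℝ) (hε : ε ∈ Set.Ioo (0 : ℝ) 1) :
    ∃ u : NonlocalTug.E N → ℝ,
      NonlocalTug.IsDPPSolution p s ε D F u ∧
      (∀ v, NonlocalTug.IsDPPSolution p s ε D F v → v = u) ∧
      (∀ x, NonlocalTug.valueI p s ε D F x = NonlocalTug.valueII p s ε D F x) ∧
      ∀ x ∈ D, NonlocalTug.valueI p s ε D F x = u x ∧ NonlocalTug.valueII p s ε D F x = u x := by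
  obtain ⟨u, hu, huniq, hval⟩ := lemma7p1_general N p s hp ⟨by linarith [hs.1], hs.2⟩ D
    hDo.measurableSet hDb F hFb hFc.continuous.measurable ε hε.1
  exact ⟨u, hu, huniq, fun x => (hval x).1.trans (hval x).2.symm,
    fun x hx => hu.eq_avgOp x hx ▸ hval x⟩
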